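/- Let $\mathbb F$ be a nonabelian free group of finite rank. For $g\ge 0$ let $H_g=\langle a_1,b_1,\dots,a_g,b_g\rangle$ be the free group of rank $2g$ and $\partial_g=[a_1,b_1]\cdots[a_g,b_g]\in H_g$, where $[a,b]=aba^{-1}b^{-1}$. A genus $g$ representation of $x\in\mathbb F$ is a homomorphism $h:H_g\to\mathbb F$ with $h(\partial_g)=x$. It is admissible if $h$ is injective and its image is a primitive subgroup of $\mathbb F$, i.e. closed under taking roots: $t\in\mathbb F$, $k\ge 1$ and $t^k\in \operatorname{im}h$ imply $t\in\operatorname{im}h$. For $x$ in the commutator subgroup $[\mathbb F,\mathbb F]$, the algebraic genus $\operatorname{agenus}(x)$ is the smallest $g\ge 0$ such that $x$ has a genus $g$ representation, and a genus $g$ representation of $x$ is minimal if $g=\operatorname{agenus}(x)$. For $g\ge 0$ set $$\hat f'_{\mathbb F}(g)=\sup\bigl\{\,\bigl|\{\operatorname{im}h : h \text{ is a minimal admissible representation of } x\}\bigr| \;:\; x\in[\mathbb F,\mathbb F],\ \operatorname{agenus}(x)=g\,\bigr\}\in\mathbb N\cup\{\infty\}.$$ Then $\hat f'_{\mathbb F}(1)\ge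 2$, and $\hat f'_{\mathbb F}(m+n)\ge \hat f'_{\mathbb F}(m)\,\hat f'_{\mathbb F}(n)$ for all integers $m,n\ge 0$. -/

import Mathlib

namespace SurfaceReps

/-- The free group `⟨a₁, b₁, …, a_g, b_g⟩` of rank `2g`, i.e. the fundamental group of the compact
orientable surface of genus `g` with one boundary component.
The generator `aᵢ` is `FreeGroup.of (i, false)` and `bᵢ` is `FreeGroup.of (i, true)`. -/
abbrev SurfaceGroup (g : ℕ) : Type := FreeGroup (Fin g × Bool)

/-- The boundary element `[a₁, b₁] ⋯ [a_g, b_g]`, where `[a, b] = a b a⁻¹ b⁻¹`. -/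
def boundary (g : ℕ) : SurfaceGroup g :=
  (List.ofFn fun i : Fin g =>
    FreeGroup.of (i, false) * FreeGroup.of (i, true) *
      (FreeGroup.of (i, false))⁻¹ * (FreeGroup.of (i, true))⁻¹).prod

/-- `h` is a genus `g` representation of `x`. -/
def IsRepresentation {F : Type*} [Group F] {g : ℕ} (x : F) (h : SurfaceGroup g →* F) : Prop :=
  h (boundary g) = x

/-- A subgroup is primitive (root-closed) if it is closed under taking roots. -/
def IsPrimitiveSubgroup {F : Type*} [Group F] (S : Subgroup F) : Prop :=
  ∀ (t : F) (n : ℕ), 0 < n → t ^ n ∈ S → t ∈ S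

/-- An injective genus `g` representation of `x` is admissible if its image is primitive. -/
def IsAdmissible {F : Type*} [Group F] {g : ℕ} (x : F) (h : SurfaceGroup g →* F) : Prop :=
  IsRepresentation x h ∧ Function.Injective h ∧ IsPrimitiveSubgroup h.range

/-- The algebraic genus of an element `x` of the commutator subgroup: the smallest `g ≥ 0` such
that `x` has a genus `g` representation. It is used only for `x ∈ commutator F`, where such a `g`
exists (`x` is a product of commutators). -/
noncomputable def algebraicGenus {F : Type*} [Group F] (x : F) : ℕ :=
  sInf {g : ℕ | ∃ h : SurfaceGroup g →* F, IsRepresentation x h}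

/-- The images of the minimal admissible representations of `x`, that is, of the admissible
representations of `x` whose genus is the algebraic genus of `x`. -/
def minimalAdmissibleImages {F : Type*} [Group F] (x : F) : Set (Subgroup F) :=
  {S | ∃ (g : ℕ) (h : SurfaceGroup g →* F), g = algebraicGenus x ∧ IsAdmissible x h ∧ h.range = S}

/-- The number (possibly infinite) of images of minimal admissible representations of `x`. -/
noncomputable def minimalCount {F : Type*} [Group F] (x : F) : ℕ∞ :=
  (minimalAdmissibleImages x).encard

/-- The supremum of `minimalCount x` over all `x` in the commutator subgroup of `F`
of algebraic genus `g`, taken in `ℕ ∪ {∞}`. -/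
noncomputable def fHat' (F : Type*) [Group F] (g : ℕ) : ℕ∞ :=
  ⨆ x ∈ {x : F | x ∈ commutator F ∧ algebraicGenus x = g}, minimalCount x

end SurfaceReps

namespace SurfaceReps

/-! Genus one: two explicit pairs of elements have the same commutator. Both generate root-closed
free subgroups of rank two, and a homomorphism to `ℤ` that kills one subgroup but not the other
tells them apart (`two_le_fHat'_one`).

Supermultiplicativity: let `x` and `y` have genera `m` and `n`, and let `d` be their product in a
free product of two copies of the group. A representation of `x` and one of `y` join to a
representation of `d`. By normal forms in free products the joined map is again injective with
root-closed image (`isRootClosedHom_coprodMap`), and the two original images are recovered by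
retracting to the factors. It remains to carry `d` back into the original free group by an injective
root-closed homomorphism that does not lower its genus. That homomorphism is chosen depending on
`d`.

Lower bounds for the genus rest on `hasPairing_iff`: an element has genus at most `g` exactly when
the letters of any word spelling it can be paired with inverse letters so that the resulting
quadratic word has genus at most `g`. The topology of the surface glued from such a polygon is
replaced by linear algebra. At most `2g` linear conditions on a weight `V` of the letters make it
vanish on the image of a genus `g` representation, and `wordSum_between_eq_zero` then says that `V`
sums to zero between a letter and its inverse. For the standard boundary word this forces `V = 0`,
so its genus is the expected one. Reducing quadratic words to boundary words then gives additivity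
of genus in free products (`of_map_mul_map`). For a general quadratic word it makes the partial sums
of `V` a function on the vertices of the glued polygon, which is the Euler characteristic inequality
in `card_le_card_vertices`. Consequently all but boundedly many corners have degree at most two.

The homomorphism back substitutes code words `a^{j₀} b a^{j₁-j₀} b ⋯` with pairwise different gaps.
If a code word has more gaps than there are bad corners, some gap is glued without interruption in
all its occurrences, hence only to inverse copies of itself. Keeping one letter from each such gap
recovers a pairing of the original word (`HasPairing.of_substWord`). Root-closedness comes from
writing code words as products of conjugates of `b` by powers of `a`. -/

/-- `x` has a representation of genus `g`, i.e. `x` is a product of `g` commutators. -/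
def HasRepresentation {G : Type*} [Group G] (g : ℕ) (x : G) : Prop :=
  ∃ h : SurfaceGroup g →* G, IsRepresentation x h

lemma HasRepresentation.map {G H : Type*} [Group G] [Group H] {g : ℕ} {x : G}
    (hx : HasRepresentation g x) (f : G →* H) : HasRepresentation g (f x) := by
  obtain ⟨h, rfl⟩ := hx
  exact ⟨f.comp h, rfl⟩

lemma algebraicGenus_le {G : Type*} [Group G] {g : ℕ} {x : G} (hx : HasRepresentation g x) :
    algebraicGenus x ≤ g :=
  Nat.sInf_le hx

/-! ### Boundary sums of surfaces -/

/-- The inclusion of the first handles. -/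
def inclLeft (m n : ℕ) : SurfaceGroup m →* SurfaceGroup (m + n) :=
  FreeGroup.map (Prod.map (Fin.castAdd n) id)

/-- The inclusion of the last handles. -/
def inclRight (m n : ℕ) : SurfaceGroup n →* SurfaceGroup (m + n) :=
  FreeGroup.map (Prod.map (Fin.natAdd m) id)

lemma boundary_add (m n : ℕ) :
    boundary (m + n) = inclLeft m n (boundary m) * inclRight m n (boundary n) := by
  have key : (fun i : Fin (m + n) => (FreeGroup.of (i, false) * FreeGroup.of (i, true) *
      (FreeGroup.of (i, false))⁻¹ * (FreeGroup.of (i, true))⁻¹ : SurfaceGroup (m + n))) =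
      Fin.append
        (fun i => inclLeft m n (FreeGroup.of (i, false) * FreeGroup.of (i, true) *
          (FreeGroup.of (i, false))⁻¹ * (FreeGroup.of (i, true))⁻¹))
        (fun i => inclRight m n (FreeGroup.of (i, false) * FreeGroup.of (i, true) *
          (FreeGroup.of (i, false))⁻¹ * (FreeGroup.of (i, true))⁻¹)) := by
    funext i
    refine Fin.addCases (fun j => ?_) (fun j => ?_) i
    · simp [inclLeft]
    · simp [inclRight]
  rw [boundary, key, List.ofFn_fin_append, List.prod_append, boundary, boundary, map_list_prod,
    map_list_prod, List.map_ofFn, List.map_ofFn]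
  rfl

/-- The homomorphism on `SurfaceGroup (m + n)` that is `f` on the first handles and `f'` on the
last ones. -/
def glue {G : Type*} [Group G] {m n : ℕ} (f : SurfaceGroup m →* G) (f' : SurfaceGroup n →* G) :
    SurfaceGroup (m + n) →* G :=
  FreeGroup.lift fun p =>
    Fin.addCases (fun i => f (FreeGroup.of (i, p.2))) (fun i => f' (FreeGroup.of (i, p.2))) p.1

lemma glue_inclLeft {G : Type*} [Group G] {m n : ℕ} (f : SurfaceGroup m →* G)
    (f' : SurfaceGroup n →* G) (x : SurfaceGroup m) : glue f f' (inclLeft m n x) = f x := by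
  suffices (glue f f').comp (inclLeft m n) = f from DFunLike.congr_fun this x
  ext p
  simp [glue, inclLeft]

lemma glue_inclRight {G : Type*} [Group G] {m n : ℕ} (f : SurfaceGroup m →* G)
    (f' : SurfaceGroup n →* G) (x : SurfaceGroup n) : glue f f' (inclRight m n x) = f' x := by
  suffices (glue f f').comp (inclRight m n) = f' from DFunLike.congr_fun this x
  ext p
  simp [glue, inclRight]

lemma glue_boundary {G : Type*} [Group G] {m n : ℕ} (f : SurfaceGroup m →* G)
    (f' : SurfaceGroup n →* G) :
    glue f f' (boundary (m + n)) = f (boundary m) * f' (boundary n) := by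
  rw [boundary_add, map_mul, glue_inclLeft, glue_inclRight]

lemma HasRepresentation.mul {G : Type*} [Group G] {m n : ℕ} {x y : G}
    (hx : HasRepresentation m x) (hy : HasRepresentation n y) :
    HasRepresentation (m + n) (x * y) := by
  obtain ⟨f, rfl⟩ := hx
  obtain ⟨f', rfl⟩ := hy
  exact ⟨glue f f', glue_boundary f f'⟩

lemma boundary_one :
    boundary 1 = FreeGroup.of (0, false) * FreeGroup.of (0, true) *
      (FreeGroup.of (0, false))⁻¹ * (FreeGroup.of (0, true))⁻¹ := by
  simp [boundary]

lemma hasRepresentation_commutator {G : Type*} [Group G] (a b : G) :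
    HasRepresentation 1 (a * b * a⁻¹ * b⁻¹) :=
  ⟨FreeGroup.lift fun p => cond p.2 b a, by simp [IsRepresentation, boundary_one]⟩

lemma hasRepresentation_zero {G : Type*} [Group G] : HasRepresentation 0 (1 : G) :=
  ⟨1, by simp [IsRepresentation]⟩

/-! ### Quadratic words and pairings of the letters of a word -/

section Letters

variable {X Y Z : Type*}

/-- The inverse of a letter. -/
def letterInv (l : Y × Bool) : Y × Bool := (l.1, !l.2)

@[simp] lemma letterInv_letterInv (l : Y × Bool) : letterInv (letterInv l) = l := by
  simp [letterInv]

lemma letterInv_ne (l : Y × Bool) : letterInv l ≠ l := by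
  intro h
  have := congrArg Prod.snd h
  simp [letterInv] at this

lemma letterInv_injective : Function.Injective (letterInv : Y × Bool → Y × Bool) :=
  Function.Involutive.injective letterInv_letterInv

/-- A word is quadratic if no letter occurs twice in it, and it contains the inverse of each of
its letters. -/
structure IsQuadratic (Q : List (Y × Bool)) : Prop where
  nodup : Q.Nodup
  inv_mem : ∀ l ∈ Q, letterInv l ∈ Q

/-- Substitution of words for the letters of a word. -/
def substWord (D : Z → List (Y × Bool)) (Q : List (Z × Bool)) : List (Y × Bool) :=
  Q.flatMap fun l => cond l.2 (D l.1) (FreeGroup.invRev (D l.1))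

lemma mk_substWord (D : Z → List (Y × Bool)) (Q : List (Z × Bool)) :
    FreeGroup.mk (substWord D Q) = FreeGroup.lift (fun z => FreeGroup.mk (D z)) (FreeGroup.mk Q) := by
  induction Q with
  | nil => simp [substWord, ← FreeGroup.one_eq_mk]
  | cons l Q ih =>
    rw [FreeGroup.lift_mk] at ih ⊢
    rw [List.map_cons, List.prod_cons, ← ih, substWord, List.flatMap_cons, ← FreeGroup.mul_mk,
      substWord]
    rcases l with ⟨z, b⟩
    cases b <;> simp [FreeGroup.inv_mk]

lemma substWord_map (D : Z → List (Y × Bool)) (lam : Y → X) (Q : List (Z × Bool)) :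
    (substWord D Q).map (Prod.map lam id) =
      substWord (fun z => (D z).map (Prod.map lam id)) Q := by
  simp only [substWord, List.map_flatMap]
  congr 1
  funext l
  rcases l with ⟨z, b⟩
  cases b <;> simp [FreeGroup.invRev, Function.comp_def]

/-- The word `D z` spelled in letters which are all distinct. -/
def taggedWord (w : Z → List (X × Bool)) (z : Z) : List ((Σ z, Fin (w z).length) × Bool) :=
  (List.finRange (w z).length).map fun k => (⟨z, k⟩, (w z)[k].2)

lemma taggedWord_map (w : Z → List (X × Bool)) (z : Z) :
    (taggedWord w z).map (Prod.map (fun y : Σ z, Fin (w z).length => (w y.1)[y.2].1) id) = w z := by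
  refine List.ext_getElem (by simp [taggedWord]) fun i h1 h2 => ?_
  simp [taggedWord]

/-- A tagged letter remembers its block and its sign, so it occurs in the block of one letter only,
and its inverse occurs in the block of the inverse letter. Both halves of being quadratic after
substitution follow from this. -/
lemma mem_taggedPiece {w : Z → List (X × Bool)} {l : Z × Bool}
    {x : (Σ z, Fin (w z).length) × Bool} :
    x ∈ cond l.2 (taggedWord w l.1) (FreeGroup.invRev (taggedWord w l.1)) ↔
      l = (x.1.1, x.2 == (w x.1.1)[x.1.2].2) := by
  rcases l with ⟨z, b⟩
  rcases x with ⟨⟨z', k⟩, c⟩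
  cases b <;>
  · simp only [taggedWord, FreeGroup.invRev, cond_true, cond_false, List.mem_map, List.mem_reverse,
      List.mem_finRange, true_and, Prod.mk.injEq, List.map_map,
      Function.comp_apply]
    constructor
    · rintro ⟨k', h, rfl⟩
      cases h
      simp
    · rintro ⟨rfl, h⟩
      refine ⟨k, rfl, ?_⟩
      revert h
      cases c <;> cases (w z)[k].2 <;> simp

lemma isQuadratic_substWord_taggedWord (w : Z → List (X × Bool)) {Q : List (Z × Bool)}
    (hQ : IsQuadratic Q) : IsQuadratic (substWord (taggedWord w) Q) := by
  constructor
  · rw [substWord, List.nodup_flatMap]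
    constructor
    · rintro ⟨z, b⟩ -
      have h : (taggedWord w z).Nodup := by
        refine (List.nodup_finRange _).map fun i j hij => ?_
        simpa using congrArg Prod.fst hij
      cases b
      · simp only [cond_false, FreeGroup.invRev, List.nodup_reverse]
        exact h.map letterInv_injective
      · exact h
    · refine hQ.nodup.imp ?_
      intro l l' hne x hx hx'
      exact hne ((mem_taggedPiece.1 hx).trans (mem_taggedPiece.1 hx').symm)
  · intro x hx
    obtain ⟨l, hl, hxl⟩ := List.mem_flatMap.1 hx
    refine List.mem_flatMap.2 ⟨letterInv l, hQ.inv_mem l hl, ?_⟩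
    rw [mem_taggedPiece] at hxl ⊢
    subst hxl
    rcases x with ⟨x, c⟩
    simp only [letterInv, Prod.mk.injEq, true_and]
    cases c <;> cases (w x.1)[x.2].2 <;> rfl

/-- The boundary element, spelled as a word. -/
def boundaryWord (g : ℕ) : List ((Fin g × Bool) × Bool) :=
  (List.finRange g).flatMap fun i =>
    [((i, false), true), ((i, true), true), ((i, false), false), ((i, true), false)]

lemma mk_boundaryWord (g : ℕ) : FreeGroup.mk (boundaryWord g) = boundary g := by
  rw [boundary, boundaryWord, List.ofFn_eq_map]
  induction List.finRange g with
  | nil => rfl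
  | cons i l ih =>
    rw [List.flatMap_cons, ← FreeGroup.mul_mk, ih, List.map_cons, List.prod_cons]
    rfl

lemma isQuadratic_boundaryWord (g : ℕ) : IsQuadratic (boundaryWord g) := by
  constructor
  · rw [boundaryWord, List.nodup_flatMap]
    refine ⟨fun i _ => by simp, (List.nodup_finRange g).imp ?_⟩
    intro i j hij x hx hx'
    simp only [List.mem_cons, List.not_mem_nil, or_false] at hx hx'
    rcases hx with rfl | rfl | rfl | rfl <;> simp [hij] at hx'
  · rintro ⟨⟨i, b⟩, c⟩ h
    simp only [boundaryWord, List.mem_flatMap, List.mem_finRange, true_and] at h ⊢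
    exact ⟨i, by cases b <;> cases c <;> simp [letterInv]⟩

/-- The word `L` is obtained from a quadratic word of genus at most `g` by identifying letters. -/
def HasPairing (g : ℕ) (L : List (X × Bool)) : Prop :=
  ∃ (Y : Type) (lam : Y → X) (Q : List (Y × Bool)), IsQuadratic Q ∧
    Q.map (Prod.map lam id) = L ∧ HasRepresentation g (FreeGroup.mk Q)

lemma HasPairing.hasRepresentation {g : ℕ} {L : List (X × Bool)} (h : HasPairing g L) :
    HasRepresentation g (FreeGroup.mk L) := by
  obtain ⟨Y, lam, Q, -, rfl, hg⟩ := h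
  exact hg.map (FreeGroup.map lam)

/-- Substitute the words of the generators' images into the boundary word. Tagging every letter
keeps the result quadratic, and it is still a homomorphic image of `boundary g`. -/
lemma exists_hasPairing (g : ℕ) (h : SurfaceGroup g →* FreeGroup X) :
    ∃ L, FreeGroup.mk L = h (boundary g) ∧ HasPairing g L := by
  classical
  let w : Fin g × Bool → List (X × Bool) := fun p => (h (FreeGroup.of p)).toWord
  refine ⟨substWord w (boundaryWord g), ?_, ?_⟩
  · rw [mk_substWord, mk_boundaryWord]
    congr 1
    ext p
    simp [w, FreeGroup.mk_toWord]
  · refine ⟨_, fun y : Σ z, Fin (w z).length => (w y.1)[y.2].1,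
      substWord (taggedWord w) (boundaryWord g),
      isQuadratic_substWord_taggedWord w (isQuadratic_boundaryWord g), ?_, ?_⟩
    · rw [substWord_map]
      simp only [taggedWord_map]
    · rw [mk_substWord, mk_boundaryWord]
      exact HasRepresentation.map ⟨MonoidHom.id _, rfl⟩ _

lemma IsQuadratic.perm {Q Q' : List (Y × Bool)} (hQ : IsQuadratic Q) (h : Q.Perm Q') :
    IsQuadratic Q' :=
  ⟨h.nodup hQ.nodup, fun l hl => h.mem_iff.1 (hQ.inv_mem l (h.mem_iff.2 hl))⟩

lemma IsQuadratic.of_cons_cons {Q : List (Y × Bool)} {l : Y × Bool}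
    (hQ : IsQuadratic (l :: letterInv l :: Q)) : IsQuadratic Q := by
  have hn := hQ.nodup
  simp only [List.nodup_cons, List.mem_cons, not_or] at hn
  refine ⟨hn.2.2, fun m hm => ?_⟩
  have := hQ.inv_mem m (by simp [hm])
  simp only [List.mem_cons] at this
  rcases this with h | h | h
  · exact absurd hm (by rw [← letterInv_letterInv m, h]; exact hn.2.1)
  · exact absurd hm (by rw [letterInv_injective h]; exact hn.1.2)
  · exact h

lemma IsQuadratic.map_of_injOn {Q : List (Y × Bool)} (hQ : IsQuadratic Q) (f : Y → Z)
    (hf : ∀ l ∈ Q, ∀ m ∈ Q, f l.1 = f m.1 → l.1 = m.1) :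
    IsQuadratic (Q.map (Prod.map f id)) := by
  constructor
  · refine List.Nodup.map_on ?_ hQ.nodup
    intro l hl m hm h
    rw [Prod.map_apply', Prod.map_apply', Prod.mk.injEq] at h
    exact Prod.ext (hf l hl m hm h.1) h.2
  · intro l hl
    obtain ⟨m, hm, rfl⟩ := List.mem_map.1 hl
    exact List.mem_map.2 ⟨letterInv m, hQ.inv_mem m hm, rfl⟩

lemma mk_cancel (P R : List (Y × Bool)) (y : Y) (b : Bool) :
    FreeGroup.mk (P ++ (y, b) :: (y, !b) :: R) = FreeGroup.mk (P ++ R) :=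
  Quot.sound FreeGroup.Red.Step.not

lemma HasPairing.step {g : ℕ} {L L' : List (X × Bool)} (h : FreeGroup.Red.Step L L') :
    HasPairing g L → HasPairing g L' := by
  classical
  rintro ⟨Y, lam, Q, hQ, hL, hg⟩
  obtain @⟨P', R', x, b⟩ := h
  obtain ⟨P, Q₁, rfl, rfl, h₁⟩ := List.map_eq_append_iff.1 hL
  obtain ⟨⟨y, c⟩, Q₂, rfl, hy, h₂⟩ := List.map_eq_cons_iff.1 h₁
  obtain ⟨⟨y', c'⟩, R, rfl, hy', rfl⟩ := List.map_eq_cons_iff.1 h₂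
  simp only [Prod.map_apply, id, Prod.mk.injEq] at hy hy'
  obtain ⟨rfl, rfl⟩ := hy
  obtain ⟨hyy, rfl⟩ := hy'
  by_cases he : y' = y
  · subst he
    refine ⟨Y, lam, P ++ R, ?_, by simp, by rwa [mk_cancel] at hg⟩
    refine (hQ.perm ?_ : IsQuadratic ((y', c) :: letterInv (y', c) :: (P ++ R))).of_cons_cons
    exact (List.perm_middle.trans (List.perm_middle.cons _))
  -- The cancelling letters belong to different pairs. Identifying `y'` with `y` makes them cancel,
  -- and their two former partners become inverse to each other. The genus cannot grow, because the
  -- new word is a homomorphic image.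
  · let f : Y → Y := fun z => if z = y' then y else z
    have hfy : f y = y := by simp [f]
    have hfy' : f y' = y := by simp [f]
    have hlf : ∀ z, lam (f z) = lam z := by
      intro z
      by_cases hz : z = y' <;> simp [f, hz, hyy]
    have hp : (P ++ (y, c) :: (y', !c) :: R).Perm ((y, c) :: (y', !c) :: (P ++ R)) :=
      List.perm_middle.trans (List.perm_middle.cons _)
    have hQ' := hQ.perm hp
    have hn' := hQ'.nodup
    simp only [List.nodup_cons, List.mem_cons, not_or] at hn'
    have hkey : ∀ l ∈ P ++ R, l.1 = y → l = (y, !c) := by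
      rintro ⟨z, e⟩ hl rfl
      cases e <;> cases c <;> simp_all
    have hkey' : ∀ l ∈ P ++ R, l.1 = y' → l = (y', c) := by
      rintro ⟨z, e⟩ hl rfl
      cases e <;> cases c <;> simp_all
    refine ⟨Y, lam, (P ++ R).map (Prod.map f id), ⟨?_, ?_⟩, ?_, ?_⟩
    · refine List.Nodup.map_on ?_ hn'.2.2
      rintro ⟨z, e⟩ hl ⟨z', e'⟩ hm h
      simp only [Prod.map_apply, id, Prod.mk.injEq] at h
      obtain ⟨hz, rfl⟩ := h
      have a1 := hkey _ hl
      have a2 := hkey _ hm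
      have a3 := hkey' _ hl
      have a4 := hkey' _ hm
      simp only [f] at hz
      have hc : ∀ {u v : Y}, (u, e) = (y, !c) → (v, e) = (y', c) → False := by
        intro u v hu hv
        have h1 := congrArg Prod.snd hu
        have h2 := congrArg Prod.snd hv
        simp only at h1 h2
        rw [h2] at h1
        cases c <;> simp at h1
      suffices z = z' by rw [this]
      split_ifs at hz with h1 h2 h2
      · exact h1.trans h2.symm
      · exact (hc (a2 hz.symm) (a3 h1)).elim
      · exact (hc (a1 hz) (a4 h2)).elim
      · exact hz
    · intro l hl
      obtain ⟨m, hm, rfl⟩ := List.mem_map.1 hl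
      have hmem := hQ'.inv_mem m (by simp only [List.mem_cons]; exact Or.inr (Or.inr hm))
      simp only [List.mem_cons] at hmem
      rcases hmem with h | h | h
      · refine List.mem_map.2 ⟨(y', c), ?_, ?_⟩
        · have := hQ'.inv_mem (y', !c) (by simp)
          simp only [letterInv, Bool.not_not, List.mem_cons, Prod.mk.injEq, he, false_and,
            false_or, true_and] at this
          rcases this with h' | h'
          · cases c <;> simp at h'
          · exact h'
        · rw [← letterInv_letterInv m, h]
          simp [letterInv, hfy, hfy']
      · refine List.mem_map.2 ⟨(y, !c), ?_, ?_⟩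
        · have := hQ'.inv_mem (y, c) (by simp)
          simp only [letterInv, List.mem_cons, Prod.mk.injEq, Ne.symm he, false_and,
            false_or, true_and] at this
          rcases this with h' | h'
          · cases c <;> simp at h'
          · exact h'
        · rw [← letterInv_letterInv m, h]
          simp [letterInv, hfy, hfy']
      · exact List.mem_map.2 ⟨_, h, rfl⟩
    · rw [List.map_map, ← List.map_append]
      exact List.map_congr_left fun l _ => Prod.ext (hlf l.1) rfl
    · have := hg.map (FreeGroup.map f)
      rw [FreeGroup.map.mk] at this
      simp only [List.map_append, List.map_cons, hfy, hfy', mk_cancel] at this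
      rw [List.map_append]
      exact this

/-- The inserted pair is tagged with a fresh letter `none`, so it cancels in the quadratic word too.
-/
lemma HasPairing.step_symm {g : ℕ} {L L' : List (X × Bool)} (h : FreeGroup.Red.Step L L') :
    HasPairing g L' → HasPairing g L := by
  rintro ⟨Y, lam, Q, hQ, hL, hg⟩
  obtain @⟨P', R', x, b⟩ := h
  obtain ⟨P, R, rfl, rfl, rfl⟩ := List.map_eq_append_iff.1 hL
  let e : Y × Bool → Option Y × Bool := Prod.map some id
  have he : Function.Injective e := (Option.some_injective Y).prodMap Function.injective_id
  refine ⟨Option Y, fun y => y.elim x lam,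
    P.map e ++ (none, b) :: (none, !b) :: R.map e, ?_, ?_, ?_⟩
  · have h1 : IsQuadratic ((P ++ R).map e) := hQ.map_of_injOn some (by simp)
    have h2 : IsQuadratic ((none, b) :: (none, !b) :: (P ++ R).map e) := by
      constructor
      · have : ∀ c, ((none : Option Y), c) ∉ (P ++ R).map e := by simp [e]
        simp only [List.nodup_cons, List.mem_cons, this, or_false]
        exact ⟨by simp, not_false, h1.nodup⟩
      · intro l hl
        simp only [List.mem_cons] at hl ⊢
        rcases hl with rfl | rfl | hl
        · simp [letterInv]
        · simp [letterInv]
        · exact Or.inr (Or.inr (h1.inv_mem l hl))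
    refine h2.perm ?_
    rw [List.map_append]
    exact (List.perm_middle.trans (List.perm_middle.cons _)).symm
  · have h : ∀ M : List (Y × Bool), (M.map e).map
        (Prod.map (fun y : Option Y => y.elim x lam) id) = M.map (Prod.map lam id) := by
      intro M
      rw [List.map_map]
      exact List.map_congr_left fun l _ => rfl
    rw [List.map_append, List.map_cons, List.map_cons, h, h]
    rfl
  · rw [mk_cancel, ← List.map_append]
    exact hg.map (FreeGroup.map some)

/-- One spelling with a pairing comes from the representation, and pairings survive insertion and
deletion of cancelling pairs. Hence every spelling has one, reduced or not. -/
lemma hasPairing_iff {g : ℕ} {L : List (X × Bool)} :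
    HasPairing g L ↔ HasRepresentation g (FreeGroup.mk L) := by
  refine ⟨HasPairing.hasRepresentation, ?_⟩
  rintro ⟨h, hh⟩
  obtain ⟨L₀, h₀, hp⟩ := exists_hasPairing g h
  have hL : FreeGroup.mk L₀ = FreeGroup.mk L := h₀.trans hh
  rw [FreeGroup.Red.exact, ← FreeGroup.eqvGen_step_iff_join_red] at hL
  suffices HasPairing g L₀ ↔ HasPairing g L from this.1 hp
  clear hp h₀ hh
  induction hL with
  | rel _ _ h => exact ⟨HasPairing.step h, HasPairing.step_symm h⟩
  | refl _ => rfl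
  | symm _ _ _ ih => exact ih.symm
  | trans _ _ _ _ _ ih1 ih2 => exact ih1.trans ih2

end Letters


lemma map_boundary_eq_one {G : Type*} [Group G] {g : ℕ} (f : SurfaceGroup g →* G)
    (hf : ∀ i, Commute (f (FreeGroup.of (i, false))) (f (FreeGroup.of (i, true)))) :
    f (boundary g) = 1 := by
  rw [boundary, map_list_prod, List.map_ofFn]
  refine List.prod_eq_one fun x hx => ?_
  obtain ⟨i, rfl⟩ := List.mem_ofFn.1 hx
  simp only [Function.comp_apply, map_mul, map_inv]
  rw [(hf i).eq]
  group

/-! ### An action detecting the heights at which a letter is read -/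

section Passage

variable {Y : Type*}

/-- The sum of the values of `V` along a word. -/
def wordSum (V : Y → ℚ) (L : List (Y × Bool)) : ℚ :=
  (L.map fun l => cond l.2 (V l.1) (-V l.1)).sum

@[simp] lemma wordSum_nil (V : Y → ℚ) : wordSum V [] = 0 := rfl

@[simp] lemma wordSum_cons (V : Y → ℚ) (l : Y × Bool) (L : List (Y × Bool)) :
    wordSum V (l :: L) = cond l.2 (V l.1) (-V l.1) + wordSum V L := by
  simp [wordSum]

@[simp] lemma wordSum_append (V : Y → ℚ) (L L' : List (Y × Bool)) :
    wordSum V (L ++ L') = wordSum V L + wordSum V L' := by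
  simp [wordSum]

lemma wordSum_add (V V' : Y → ℚ) (L : List (Y × Bool)) :
    wordSum (V + V') L = wordSum V L + wordSum V' L := by
  induction L with
  | nil => simp
  | cons l L ih =>
    rw [wordSum_cons, wordSum_cons, wordSum_cons, ih]
    cases l.2 <;> simp <;> ring

lemma wordSum_smul (c : ℚ) (V : Y → ℚ) (L : List (Y × Bool)) :
    wordSum (c • V) L = c * wordSum V L := by
  induction L with
  | nil => simp
  | cons l L ih =>
    rw [wordSum_cons, wordSum_cons, ih]
    cases l.2 <;> simp <;> ring

/-- The homomorphism to `ℚ` with the values `V` on the generators. -/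
def sumHom (V : Y → ℚ) : FreeGroup Y →* Multiplicative ℚ :=
  FreeGroup.lift fun y => Multiplicative.ofAdd (V y)

lemma sumHom_mk (V : Y → ℚ) (L : List (Y × Bool)) :
    sumHom V (FreeGroup.mk L) = Multiplicative.ofAdd (wordSum V L) := by
  rw [sumHom, FreeGroup.lift_mk]
  induction L with
  | nil => simp
  | cons l L ih =>
    rw [List.map_cons, List.prod_cons, ih, wordSum_cons]
    cases l.2 <;> simp

variable [DecidableEq Y]

/-- Reading a generator `y` at height `s` adds `s` to the coordinate `y`, and `V y` to the height. -/
def letterPerm (V : Y → ℚ) (y : Y) : Equiv.Perm (ℚ × (Y → ℚ)) where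
  toFun p := (p.1 + V y, p.2 + Pi.single y p.1)
  invFun p := (p.1 - V y, p.2 - Pi.single y (p.1 - V y))
  left_inv p := by simp
  right_inv p := by simp

/-- The action of the free group that extends `letterPerm`. -/
def passage (V : Y → ℚ) : FreeGroup Y →* Equiv.Perm (ℚ × (Y → ℚ)) :=
  FreeGroup.lift (letterPerm V)

lemma exists_passage_apply (V : Y → ℚ) (x : FreeGroup Y) :
    ∃ C : ℚ → Y → ℚ, ∀ p, passage V x p = (p.1 + (sumHom V x).toAdd, p.2 + C p.1) := by
  induction x using FreeGroup.induction_on with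
  | C1 => exact ⟨0, fun p => by simp⟩
  | of y => exact ⟨fun s => Pi.single y s, fun p => by simp [passage, sumHom, letterPerm]⟩
  | inv_of y _ =>
    refine ⟨fun s => -Pi.single y (s - V y), fun p => ?_⟩
    rw [map_inv, Equiv.Perm.inv_eq_iff_eq]
    simp [passage, sumHom, letterPerm, sub_eq_add_neg]
  | mul x y hx hy =>
    obtain ⟨C, hC⟩ := hx
    obtain ⟨D, hD⟩ := hy
    refine ⟨fun s => D s + C (s + (sumHom V y).toAdd), fun p => ?_⟩
    rw [map_mul, Equiv.Perm.mul_apply, hD, hC, map_mul, toAdd_mul]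
    refine Prod.ext ?_ ?_
    · simp only; ring
    · simp only [add_assoc]

/-- Elements of total height zero preserve the height and translate the other coordinates by a
vector that depends on the height alone; such maps commute. -/
lemma passage_commute {V : Y → ℚ} {x y : FreeGroup Y} (hx : sumHom V x = 1)
    (hy : sumHom V y = 1) : Commute (passage V x) (passage V y) := by
  obtain ⟨C, hC⟩ := exists_passage_apply V x
  obtain ⟨D, hD⟩ := exists_passage_apply V y
  ext1 p
  simp only [Equiv.Perm.mul_apply, hC, hD, hx, hy, toAdd_one, add_zero]
  rw [add_right_comm]

lemma passage_boundary {g : ℕ} {V : Y → ℚ} (h : SurfaceGroup g →* FreeGroup Y)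
    (hV : ∀ p, sumHom V (h (FreeGroup.of p)) = 1) : passage V (h (boundary g)) = 1 :=
  map_boundary_eq_one ((passage V).comp h) fun _ => passage_commute (hV _) (hV _)

lemma passage_mk_cons (V : Y → ℚ) (l : Y × Bool) (L : List (Y × Bool)) (p : ℚ × (Y → ℚ)) :
    passage V (FreeGroup.mk (l :: L)) p =
      cond l.2 (letterPerm V l.1) (letterPerm V l.1)⁻¹ (passage V (FreeGroup.mk L) p) := by
  rw [passage, FreeGroup.lift_mk, FreeGroup.lift_mk, List.map_cons, List.prod_cons,
    Equiv.Perm.mul_apply]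

lemma passage_mk_append (V : Y → ℚ) (L L' : List (Y × Bool)) (p : ℚ × (Y → ℚ)) :
    passage V (FreeGroup.mk (L ++ L')) p =
      passage V (FreeGroup.mk L) (passage V (FreeGroup.mk L') p) := by
  rw [← FreeGroup.mul_mk, map_mul, Equiv.Perm.mul_apply]

lemma passage_fst (V : Y → ℚ) (L : List (Y × Bool)) (p : ℚ × (Y → ℚ)) :
    (passage V (FreeGroup.mk L) p).1 = p.1 + wordSum V L := by
  obtain ⟨C, hC⟩ := exists_passage_apply V (FreeGroup.mk L)
  rw [hC, sumHom_mk]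
  rfl

lemma passage_snd_of_notMem (V : Y → ℚ) {L : List (Y × Bool)} {y : Y} (hy : ∀ l ∈ L, l.1 ≠ y)
    (p : ℚ × (Y → ℚ)) : (passage V (FreeGroup.mk L) p).2 y = p.2 y := by
  induction L with
  | nil => simp [← FreeGroup.one_eq_mk]
  | cons l L ih =>
    have hl := hy l (by simp)
    rw [passage_mk_cons, ← ih fun m hm => hy m (by simp [hm])]
    cases l.2
    · change (_ - Pi.single l.1 _ : Y → ℚ) y = _
      simp [Pi.single_eq_of_ne hl.symm]
    · change (_ + Pi.single l.1 _ : Y → ℚ) y = _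
      simp [Pi.single_eq_of_ne hl.symm]

/-- If `V` vanishes on the image of a representation of a quadratic word, then it vanishes on
each subword between a letter and its inverse. -/
lemma wordSum_between_eq_zero {g : ℕ} {V : Y → ℚ} {A B C : List (Y × Bool)} {l : Y × Bool}
    (hn : (A ++ l :: (B ++ letterInv l :: C)).Nodup) (h : SurfaceGroup g →* FreeGroup Y)
    (hh : h (boundary g) = FreeGroup.mk (A ++ l :: (B ++ letterInv l :: C)))
    (hV : ∀ p, sumHom V (h (FreeGroup.of p)) = 1) : wordSum V B = 0 := by
  have h1 := passage_boundary h hV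
  rw [hh] at h1
  have h2 := congrFun (congrArg Prod.snd (Equiv.congr_fun h1 (0, 0))) l.1
  have hp : (A ++ l :: (B ++ letterInv l :: C)).Perm (l :: letterInv l :: (A ++ (B ++ C))) := by
    refine List.perm_middle.trans (List.Perm.cons _ ?_)
    rw [← List.append_assoc, ← List.append_assoc]
    exact List.perm_middle
  have hn' := hp.nodup hn
  simp only [List.nodup_cons, List.mem_cons, not_or] at hn'
  have hne : ∀ m ∈ A ++ (B ++ C), m.1 ≠ l.1 := by
    rintro ⟨y, b⟩ hm rfl
    rcases l with ⟨y, c⟩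
    obtain rfl | rfl : b = c ∨ b = !c := by cases b <;> cases c <;> simp
    · exact hn'.1.2 hm
    · exact hn'.2.1 hm
  -- Only `l` and its inverse move the coordinate `l.1`. They add opposite heights, measured on the
  -- two sides of `B`, and the total change is zero.
  rw [passage_mk_append, passage_snd_of_notMem V fun m hm => hne m (by simp [hm]),
    passage_mk_cons, passage_mk_append, passage_mk_cons] at h2
  have hB := passage_snd_of_notMem V (L := B) (y := l.1) fun m hm => hne m (by simp [hm])
  have hC := passage_snd_of_notMem V (L := C) (y := l.1) fun m hm => hne m (by simp [hm])
  have hB1 := passage_fst V B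
  have hC1 := passage_fst V C (0, 0)
  rcases l with ⟨y, b⟩
  set q := passage V (FreeGroup.mk C) (0, 0)
  have hq := hC (0, 0)
  cases b
  · change ((passage V (FreeGroup.mk B) (q.1 + V y, q.2 + Pi.single y q.1)).2 - Pi.single y
      ((passage V (FreeGroup.mk B) (q.1 + V y, q.2 + Pi.single y q.1)).1 - V y) : Y → ℚ) y
      = 0 at h2
    rw [Pi.sub_apply, hB, hB1] at h2
    simp at h2
    simp at hq
    linarith
  · change ((passage V (FreeGroup.mk B) (q.1 - V y, q.2 - Pi.single y (q.1 - V y))).2 + Pi.single y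
      ((passage V (FreeGroup.mk B) (q.1 - V y, q.2 - Pi.single y (q.1 - V y))).1) : Y → ℚ) y
      = 0 at h2
    rw [Pi.add_apply, hB, hB1] at h2
    simp at h2
    simp at hq
    linarith

end Passage

/-! ### Dimension count and the genus of the standard boundary word -/

section Annihilator

variable {Y : Type*}

/-- The functions on the generators for which the homomorphism to `ℚ` vanishes on the image
of `h`. -/
noncomputable def annihilator {g : ℕ} (h : SurfaceGroup g →* FreeGroup Y) : Submodule ℚ (Y → ℚ) :=
  LinearMap.ker (LinearMap.pi (R := ℚ) (φ := fun _ : Fin g × Bool => ℚ) fun p =>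
    -- Any spelling would do: the sum depends only on the group element.
    { toFun := fun V => wordSum V (Quot.out (h (FreeGroup.of p)))
      map_add' := fun V V' => wordSum_add V V' _
      map_smul' := fun c V => wordSum_smul c V _ })

lemma mem_annihilator {g : ℕ} {h : SurfaceGroup g →* FreeGroup Y} {V : Y → ℚ} :
    V ∈ annihilator h ↔ ∀ p, sumHom V (h (FreeGroup.of p)) = 1 := by
  rw [annihilator, LinearMap.mem_ker, funext_iff]
  refine forall_congr' fun p => ?_
  have : FreeGroup.mk (Quot.out (h (FreeGroup.of p))) = h (FreeGroup.of p) := Quot.out_eq _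
  rw [← this, sumHom_mk, ofAdd_eq_one]
  rfl

lemma le_finrank_annihilator [Fintype Y] {g : ℕ} (h : SurfaceGroup g →* FreeGroup Y) :
    Fintype.card Y ≤ Module.finrank ℚ (annihilator h) + 2 * g := by
  have h1 := LinearMap.finrank_range_add_finrank_ker
    (LinearMap.pi (R := ℚ) (φ := fun _ : Fin g × Bool => ℚ) fun p =>
    { toFun := fun V : Y → ℚ => wordSum V (Quot.out (h (FreeGroup.of p)))
      map_add' := fun V V' => wordSum_add V V' _
      map_smul' := fun c V => wordSum_smul c V _ })
  have h2 := Submodule.finrank_le (LinearMap.range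
    (LinearMap.pi (R := ℚ) (φ := fun _ : Fin g × Bool => ℚ) fun p =>
    { toFun := fun V : Y → ℚ => wordSum V (Quot.out (h (FreeGroup.of p)))
      map_add' := fun V V' => wordSum_add V V' _
      map_smul' := fun c V => wordSum_smul c V _ }))
  rw [Module.finrank_fintype_fun_eq_card] at h1 h2
  rw [Fintype.card_prod, Fintype.card_fin, Fintype.card_bool] at h2
  rw [annihilator]
  omega

/-- Between `aᵢ` and its inverse stands only `bᵢ`, and between `bᵢ` and its inverse only the inverse
of `aᵢ`. So a weight vanishing on the image is zero, and the `2g` conditions must cut out all `2r`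
dimensions. -/
lemma le_of_hasRepresentation_boundary {g r : ℕ} (hr : HasRepresentation g (boundary r)) :
    r ≤ g := by
  obtain ⟨h, hh⟩ := hr
  have hbot : annihilator h = ⊥ := by
    rw [eq_bot_iff]
    intro V hV
    rw [mem_annihilator] at hV
    rw [Submodule.mem_bot]
    ext ⟨i, b⟩
    obtain ⟨s, t, hst⟩ := List.append_of_mem (List.mem_finRange i)
    have hw : boundaryWord r = (s.flatMap fun i =>
        [((i, false), true), ((i, true), true), ((i, false), false), ((i, true), false)]) ++
        ([((i, false), true), ((i, true), true), ((i, false), false), ((i, true), false)] ++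
        t.flatMap fun i =>
        [((i, false), true), ((i, true), true), ((i, false), false), ((i, true), false)]) := by
      rw [boundaryWord, hst, List.flatMap_append, List.flatMap_cons]
    have hn := (isQuadratic_boundaryWord r).nodup
    -- The pipe discards `boundary r`: the left side is `h (boundary g)`.
    have hb : h (boundary r |> fun _ => boundary g) = FreeGroup.mk (boundaryWord r) := by
      rw [mk_boundaryWord]
      exact hh
    rw [hw] at hn hb
    generalize (s.flatMap fun i : Fin r =>
        [((i, false), true), ((i, true), true), ((i, false), false), ((i, true), false)]) = S
      at hn hb
    generalize (t.flatMap fun i : Fin r =>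
        [((i, false), true), ((i, true), true), ((i, false), false), ((i, true), false)]) = T
      at hn hb
    cases b
    · have := wordSum_between_eq_zero (A := S ++ [((i, false), true)]) (l := ((i, true), true))
        (B := [((i, false), false)]) (C := T) (by simpa [letterInv] using hn) h
        (by simpa [letterInv] using hb) hV
      simpa using this
    · have := wordSum_between_eq_zero (A := S) (l := ((i, false), true))
        (B := [((i, true), true)]) (C := ((i, true), false) :: T) (by simpa [letterInv] using hn) h
        (by simpa [letterInv] using hb) hV
      simpa using this
  have := le_finrank_annihilator h
  rw [hbot, finrank_bot, Fintype.card_prod, Fintype.card_fin, Fintype.card_bool] at this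
  omega

end Annihilator

/-! ### Normal form of quadratic words and additivity of the genus -/

section NormalForm

variable {X Y : Type*}

lemma hom_mk_congr {G : Type*} [Group G] (f f' : FreeGroup Y →* G) {L : List (Y × Bool)}
    (h : ∀ l ∈ L, f (FreeGroup.of l.1) = f' (FreeGroup.of l.1)) :
    f (FreeGroup.mk L) = f' (FreeGroup.mk L) := by
  induction L with
  | nil => rw [← FreeGroup.one_eq_mk, map_one, map_one]
  | cons l L ih =>
    have h1 : f (FreeGroup.mk [l]) = f' (FreeGroup.mk [l]) := by
      rcases l with ⟨y, b⟩
      cases b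
      · have := congrArg (·⁻¹) (h (y, false) (by simp))
        simp only [← map_inv, FreeGroup.of, FreeGroup.inv_mk] at this
        exact this
      · exact h (y, true) (by simp)
    rw [show l :: L = [l] ++ L from rfl, ← FreeGroup.mul_mk, map_mul, map_mul, h1,
      ih fun m hm => h m (by simp [hm])]

lemma mk_letterInv (l : Y × Bool) : FreeGroup.mk [letterInv l] = (FreeGroup.mk [l])⁻¹ := by
  simp [FreeGroup.inv_mk, FreeGroup.invRev, letterInv]

lemma mk_cons' (l : Y × Bool) (L : List (Y × Bool)) :
    FreeGroup.mk (l :: L) = FreeGroup.mk [l] * FreeGroup.mk L := by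
  rw [FreeGroup.mul_mk]
  rfl

lemma lift_mk_singleton {G : Type*} [Group G] (f : Y → G) (l : Y × Bool) (u : G)
    (h : f l.1 = cond l.2 u u⁻¹) : FreeGroup.lift f (FreeGroup.mk [l]) = u := by
  rcases l with ⟨y, b⟩
  rw [FreeGroup.lift_mk]
  cases b <;> simp_all

/-- A quadratic word is equivalent to a boundary element. -/
lemma IsQuadratic.exists_normalForm {Q : List (Y × Bool)} (hQ : IsQuadratic Q) :
    ∃ r, HasRepresentation r (FreeGroup.mk Q) ∧
      ∃ f : FreeGroup Y →* SurfaceGroup r, f (FreeGroup.mk Q) = boundary r := by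
  classical
  induction hn : Q.length using Nat.strong_induction_on generalizing Q with
  | _ n ih =>
  subst hn
  rcases Q with _ | ⟨l, Q₀⟩
  · exact ⟨0, hasRepresentation_zero, 1, by simp [boundary]⟩
  have hl : letterInv l ∈ Q₀ := by
    have := hQ.inv_mem l (by simp)
    rw [List.mem_cons] at this
    exact this.resolve_left (letterInv_ne l)
  obtain ⟨Q₁, Q₂, rfl⟩ := List.append_of_mem hl
  have hp : (l :: (Q₁ ++ letterInv l :: Q₂)).Perm (l :: letterInv l :: (Q₁ ++ Q₂)) :=
    List.perm_middle.cons _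
  have hQ' := hQ.perm hp
  have h12 := hQ'.of_cons_cons
  have hnd := hQ'.nodup
  simp only [List.nodup_cons, List.mem_cons, not_or] at hnd
  have hne : ∀ m ∈ Q₁ ++ Q₂, m.1 ≠ l.1 := by
    rintro ⟨y, b⟩ hm rfl
    rcases l with ⟨y, c⟩
    obtain rfl | rfl : b = c ∨ b = !c := by cases b <;> cases c <;> simp
    · exact hnd.1.2 hm
    · exact hnd.2.1 hm
  have h12n := List.nodup_append'.1 h12.nodup
  -- If no pair interlaces with that of `l`, the word is a conjugate of `Q₁` times `Q₂`, and the two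
  -- parts are treated separately. Otherwise an interlacing pair `m` splits off a handle.
  by_cases hc : ∀ m ∈ Q₁, letterInv m ∈ Q₁
  · have hQ₁ : IsQuadratic Q₁ := ⟨h12n.1, hc⟩
    have hQ₂ : IsQuadratic Q₂ := by
      refine ⟨h12n.2.1, fun m hm => ?_⟩
      have := h12.inv_mem m (by simp [hm])
      rw [List.mem_append] at this
      refine this.resolve_left fun h => h12n.2.2 (hc _ h) ?_
      rwa [letterInv_letterInv]
    obtain ⟨r₁, hr₁, f₁, hf₁⟩ := ih Q₁.length
      (by simp only [List.length_cons, List.length_append]; omega) hQ₁ rfl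
    obtain ⟨r₂, hr₂, f₂, hf₂⟩ := ih Q₂.length
      (by simp only [List.length_cons, List.length_append]; omega) hQ₂ rfl
    refine ⟨r₁ + r₂, ?_, FreeGroup.lift fun y => if ∃ b, (y, b) ∈ Q₁ then
      inclLeft r₁ r₂ (f₁ (FreeGroup.of y)) else if y = l.1 then 1 else
      inclRight r₁ r₂ (f₂ (FreeGroup.of y)), ?_⟩
    · rw [mk_cons', ← FreeGroup.mul_mk, mk_cons' _ Q₂, mk_letterInv, ← mul_assoc, ← mul_assoc]
      exact (hr₁.map (MulAut.conj (FreeGroup.mk [l])).toMonoidHom).mul hr₂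
    · rw [mk_cons', ← FreeGroup.mul_mk, mk_cons' _ Q₂, mk_letterInv, map_mul, map_mul, map_mul,
        map_inv, lift_mk_singleton _ l 1, boundary_add, ← hf₁, ← hf₂, one_mul, inv_one, one_mul]
      · congr 1
        · refine hom_mk_congr _ ((inclLeft r₁ r₂).comp f₁) fun m hm => ?_
          rw [FreeGroup.lift_apply_of, if_pos ⟨m.2, hm⟩]
          rfl
        · refine hom_mk_congr _ ((inclRight r₁ r₂).comp f₂) fun m hm => ?_
          rw [FreeGroup.lift_apply_of, if_neg, if_neg (hne m (by simp [hm]))]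
          · rfl
          · rintro ⟨b, hb⟩
            rcases m with ⟨y, c⟩
            obtain rfl | rfl : b = c ∨ b = !c := by cases b <;> cases c <;> simp
            · exact h12n.2.2 hb hm
            · refine h12n.2.2 (hc _ hb) ?_
              simpa [letterInv] using hm
      · rw [if_neg, if_pos rfl]
        · cases l.2 <;> simp
        · rintro ⟨b, hb⟩
          exact hne (l.1, b) (by simp [hb]) rfl
  · push Not at hc
    obtain ⟨m, hm, hm'⟩ := hc
    obtain ⟨A, B, rfl⟩ := List.append_of_mem hm
    have hm₂ : letterInv m ∈ Q₂ := by
      have := h12.inv_mem m (by simp)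
      rw [List.mem_append] at this
      exact this.resolve_left hm'
    obtain ⟨C, D, rfl⟩ := List.append_of_mem hm₂
    have hp₂ : (A ++ m :: B ++ (C ++ letterInv m :: D)).Perm
        (m :: letterInv m :: (C ++ B ++ (A ++ D))) := by
      classical
      rw [List.perm_iff_count]
      intro a
      simp only [List.count_append, List.count_cons]
      omega
    have h12' := h12.perm hp₂
    have hR := h12'.of_cons_cons
    have hnd₂ := h12'.nodup
    simp only [List.nodup_cons, List.mem_cons, not_or] at hnd₂
    have hneR : ∀ x ∈ C ++ B ++ (A ++ D), x.1 ≠ l.1 := by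
      intro x hx
      refine hne x (hp₂.mem_iff.2 ?_)
      simp only [List.mem_cons]
      exact Or.inr (Or.inr hx)
    have hneR' : ∀ x ∈ C ++ B ++ (A ++ D), x.1 ≠ m.1 := by
      rintro ⟨y, b⟩ hx rfl
      rcases m with ⟨y, c⟩
      obtain rfl | rfl : b = c ∨ b = !c := by cases b <;> cases c <;> simp
      · exact hnd₂.1.2 hx
      · exact hnd₂.2.1 hx
    have hml : m.1 ≠ l.1 := hne m (by simp)
    obtain ⟨r, hr, f, hf⟩ := ih (C ++ B ++ (A ++ D)).length (by simp only [List.length_cons, List.length_append]; omega) hR rfl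
    have hq : FreeGroup.mk (l :: (A ++ m :: B ++ letterInv l :: (C ++ letterInv m :: D))) =
        FreeGroup.mk [l] * FreeGroup.mk A * FreeGroup.mk [m] * FreeGroup.mk B *
        (FreeGroup.mk [l])⁻¹ * FreeGroup.mk C * (FreeGroup.mk [m])⁻¹ * FreeGroup.mk D := by
      rw [mk_cons', ← FreeGroup.mul_mk, ← FreeGroup.mul_mk, mk_cons' _ B, mk_cons' _ (C ++ _),
        ← FreeGroup.mul_mk, mk_cons' _ D, mk_letterInv, mk_letterInv]
      simp only [mul_assoc]
    have hR' : FreeGroup.mk (C ++ B ++ (A ++ D)) = FreeGroup.mk C * FreeGroup.mk B *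
        (FreeGroup.mk A * FreeGroup.mk D) := by
      simp only [FreeGroup.mul_mk]
    refine ⟨1 + r, ?_, ?_⟩
    · rw [hq]
      rw [hR'] at hr
      generalize FreeGroup.mk [l] = y at *
      generalize FreeGroup.mk [m] = z at *
      generalize FreeGroup.mk A = a at *
      generalize FreeGroup.mk B = b at *
      generalize FreeGroup.mk C = c at *
      generalize FreeGroup.mk D = d at *
      -- The handle identity: `y a z b y⁻¹ c z⁻¹ d` is this commutator times `c b a d`.
      have := (hasRepresentation_commutator (y * (c * b)⁻¹) (c * b * a * z * b * (c * b)⁻¹)).mul hr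
      convert this using 1
      group
    · let i := (inclRight 1 r).comp f
      let E := i (FreeGroup.mk C) * i (FreeGroup.mk B)
      -- `u` and `v` solve the handle identity for `y` and `z`: with these values the entries of its
      -- commutator become the generators of the new handle.
      let u : SurfaceGroup (1 + r) := FreeGroup.of (0, false) * E
      let v : SurfaceGroup (1 + r) := (i (FreeGroup.mk A))⁻¹ * E⁻¹ * FreeGroup.of (0, true) * E *
        (i (FreeGroup.mk B))⁻¹
      let φ : FreeGroup Y →* SurfaceGroup (1 + r) := FreeGroup.lift fun y =>
        if y = l.1 then cond l.2 u u⁻¹ else if y = m.1 then cond m.2 v v⁻¹ else i (FreeGroup.of y)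
      have hφ : ∀ L : List (Y × Bool), (∀ x ∈ L, x ∈ C ++ B ++ (A ++ D)) →
          φ (FreeGroup.mk L) = i (FreeGroup.mk L) := by
        intro L hL
        refine hom_mk_congr _ _ fun x hx => ?_
        rw [FreeGroup.lift_apply_of, if_neg (hneR x (hL x hx)), if_neg (hneR' x (hL x hx))]
      have hφl : φ (FreeGroup.mk [l]) = u := lift_mk_singleton _ _ _ (if_pos rfl)
      have hφm : φ (FreeGroup.mk [m]) = v :=
        lift_mk_singleton _ _ _ (by rw [if_neg hml, if_pos rfl])
      refine ⟨φ, ?_⟩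
      have h1 : inclLeft 1 r (boundary 1) = (FreeGroup.of (0, false) * FreeGroup.of (0, true) *
          (FreeGroup.of (0, false))⁻¹ * (FreeGroup.of (0, true))⁻¹ : SurfaceGroup (1 + r)) := by
        rw [boundary_one]
        simp only [inclLeft, map_mul, map_inv, FreeGroup.map.of]
        rfl
      have h2 : inclRight 1 r (boundary r) = E * (i (FreeGroup.mk A) * i (FreeGroup.mk D)) := by
        rw [← hf, hR']
        simp only [map_mul]
        rfl
      rw [hq]
      simp only [map_mul, map_inv]
      rw [hφl, hφm, hφ A (by simp +contextual), hφ B (by simp +contextual),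
        hφ C (by simp +contextual), hφ D (by simp +contextual), boundary_add, h1, h2]
      have hE : E = i (FreeGroup.mk C) * i (FreeGroup.mk B) := rfl
      simp only [u, v]
      generalize i (FreeGroup.mk A) = a at *
      generalize i (FreeGroup.mk B) = b at *
      generalize i (FreeGroup.mk D) = d at *
      have hC : i (FreeGroup.mk C) = E * b⁻¹ := by rw [hE]; group
      rw [hC]
      generalize E = e
      group

/-- The genus of a product of words in disjoint alphabets is at least the sum of the genera. -/
lemma HasRepresentation.of_mul_of_disjoint {g : ℕ} {Q₁ Q₂ : List (Y × Bool)}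
    (hQ₁ : IsQuadratic Q₁) (hQ₂ : IsQuadratic Q₂) (hd : ∀ l ∈ Q₁, ∀ m ∈ Q₂, l.1 ≠ m.1)
    (h : HasRepresentation g (FreeGroup.mk (Q₁ ++ Q₂))) :
    ∃ r₁ r₂, r₁ + r₂ ≤ g ∧ HasRepresentation r₁ (FreeGroup.mk Q₁) ∧
      HasRepresentation r₂ (FreeGroup.mk Q₂) := by
  classical
  obtain ⟨r₁, hr₁, f₁, hf₁⟩ := hQ₁.exists_normalForm
  obtain ⟨r₂, hr₂, f₂, hf₂⟩ := hQ₂.exists_normalForm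
  refine ⟨r₁, r₂, le_of_hasRepresentation_boundary ?_, hr₁, hr₂⟩
  -- As the alphabets are disjoint, both words can be sent to their boundary elements at once, so
  -- their product maps to `boundary (r₁ + r₂)`.
  have := h.map (FreeGroup.lift fun y => if ∃ b, (y, b) ∈ Q₁ then
      inclLeft r₁ r₂ (f₁ (FreeGroup.of y)) else inclRight r₁ r₂ (f₂ (FreeGroup.of y)))
  convert this using 1
  rw [← FreeGroup.mul_mk, map_mul, boundary_add, ← hf₁, ← hf₂]
  congr 1
  · refine (hom_mk_congr _ ((inclLeft r₁ r₂).comp f₁) fun m hm => ?_).symm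
    rw [FreeGroup.lift_apply_of, if_pos ⟨m.2, hm⟩]
    rfl
  · refine (hom_mk_congr _ ((inclRight r₁ r₂).comp f₂) fun m hm => ?_).symm
    rw [FreeGroup.lift_apply_of, if_neg]
    · rfl
    · rintro ⟨b, hb⟩
      exact hd _ hb m hm rfl

/-- The genus is superadditive in free products of free groups. -/
theorem HasRepresentation.of_map_mul_map {g : ℕ} {x y : FreeGroup X}
    (h : HasRepresentation g (FreeGroup.map (Prod.mk false) x * FreeGroup.map (Prod.mk true) y)) :
    ∃ r₁ r₂, r₁ + r₂ ≤ g ∧ HasRepresentation r₁ x ∧ HasRepresentation r₂ y := by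
  classical
  rw [← FreeGroup.mk_toWord (x := x), ← FreeGroup.mk_toWord (x := y), FreeGroup.map.mk,
    FreeGroup.map.mk, FreeGroup.mul_mk, ← hasPairing_iff] at h
  obtain ⟨Y, lam, Q, hQ, hL, hg⟩ := h
  obtain ⟨Q₁, Q₂, rfl, h₁, h₂⟩ := List.map_eq_append_iff.1 hL
  have hl₁ : ∀ l ∈ Q₁, (lam l.1).1 = false := by
    intro l hl
    have : Prod.map lam id l ∈ Q₁.map (Prod.map lam id) := List.mem_map.2 ⟨l, hl, rfl⟩
    rw [h₁] at this
    obtain ⟨p, -, hp⟩ := List.mem_map.1 this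
    exact (congrArg (fun q => q.1.1) hp).symm
  have hl₂ : ∀ l ∈ Q₂, (lam l.1).1 = true := by
    intro l hl
    have : Prod.map lam id l ∈ Q₂.map (Prod.map lam id) := List.mem_map.2 ⟨l, hl, rfl⟩
    rw [h₂] at this
    obtain ⟨p, -, hp⟩ := List.mem_map.1 this
    exact (congrArg (fun q => q.1.1) hp).symm
  have hn := List.nodup_append'.1 hQ.nodup
  -- Paired letters carry the same label, so no pair joins the two copies of the alphabet.
  have hq₁ : IsQuadratic Q₁ := by
    refine ⟨hn.1, fun l hl => ?_⟩
    have := hQ.inv_mem l (by simp [hl])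
    rw [List.mem_append] at this
    refine this.resolve_right fun h => ?_
    have h1 := hl₁ l hl
    have h2 := hl₂ _ h
    simp only [letterInv] at h2
    rw [h1] at h2
    simp at h2
  have hq₂ : IsQuadratic Q₂ := by
    refine ⟨hn.2.1, fun l hl => ?_⟩
    have := hQ.inv_mem l (by simp [hl])
    rw [List.mem_append] at this
    refine this.resolve_left fun h => ?_
    have h1 := hl₂ l hl
    have h2 := hl₁ _ h
    simp only [letterInv] at h2
    rw [h1] at h2
    simp at h2
  obtain ⟨r₁, r₂, hr, hr₁, hr₂⟩ := hg.of_mul_of_disjoint hq₁ hq₂ fun l hl m hm he => by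
    have h1 := hl₁ l hl
    have h2 := hl₂ m hm
    rw [he, h2] at h1
    simp at h1
  have key : ∀ (b : Bool) (Q : List (Y × Bool)) (z : FreeGroup X),
      Q.map (Prod.map lam id) = z.toWord.map (fun p => ((b, p.1), p.2)) →
      FreeGroup.map (fun y => (lam y).2) (FreeGroup.mk Q) = z := by
    intro b Q z hz
    have := congrArg (List.map (Prod.map Prod.snd id)) hz
    rw [List.map_map, List.map_map] at this
    rw [FreeGroup.map.mk]
    refine Eq.trans (congrArg FreeGroup.mk ?_) (FreeGroup.mk_toWord (x := z))
    refine Eq.trans ?_ (this.trans ?_)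
    · rfl
    · exact List.map_id _
  refine ⟨r₁, r₂, hr, ?_, ?_⟩
  · have := hr₁.map (FreeGroup.map fun y => (lam y).2)
    rwa [key _ _ _ h₁] at this
  · have := hr₂.map (FreeGroup.map fun y => (lam y).2)
    rwa [key _ _ _ h₂] at this

end NormalForm


/-! ### Vertices of the glued polygon and the Euler characteristic bound -/

section VertexCount

variable {Y : Type*} [DecidableEq Y]

lemma formPerm_apply_of_eq_append {α : Type*} [DecidableEq α] {Q A B : List α} {l m : α}
    (hn : Q.Nodup) (h : Q = A ++ l :: m :: B) : Q.formPerm l = m := by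
  subst h
  have := List.formPerm_apply_lt_getElem _ hn A.length (by simp)
  simpa using this

/-- The inversion of letters, as a permutation. -/
def letterInvPerm : Equiv.Perm (Y × Bool) where
  toFun := letterInv
  invFun := letterInv
  left_inv := letterInv_letterInv
  right_inv := letterInv_letterInv

/-- The permutation of the corners of a cyclic word whose cycles are the vertices of the surface
obtained by gluing each letter to its inverse; a corner is named by the letter that precedes it. -/
def vertexPerm (Q : List (Y × Bool)) : Equiv.Perm (Y × Bool) :=
  Q.formPerm⁻¹ * letterInvPerm

lemma vertexPerm_eq_iff {Q : List (Y × Bool)} {l m : Y × Bool} :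
    vertexPerm Q l = m ↔ Q.formPerm m = letterInv l := by
  rw [vertexPerm, Equiv.Perm.mul_apply, Equiv.Perm.inv_eq_iff_eq, eq_comm]
  rfl

/-- The sum of `V` over the letters of `Q` after `l`. -/
def suffixSum (Q : List (Y × Bool)) (V : Y → ℚ) (l : Y × Bool) : ℚ :=
  wordSum V (Q.drop (Q.idxOf l + 1))

lemma suffixSum_of_eq_append {Q A B : List (Y × Bool)} {l : Y × Bool} (V : Y → ℚ)
    (hn : Q.Nodup) (h : Q = A ++ l :: B) : suffixSum Q V l = wordSum V B := by
  subst h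
  have hA : l ∉ A := by
    intro hl
    exact (List.nodup_append'.1 hn).2.2 hl (by simp)
  rw [suffixSum, List.idxOf_append_of_notMem hA]
  simp

lemma suffixSum_formPerm {Q : List (Y × Bool)} {V : Y → ℚ} {l : Y × Bool} (hn : Q.Nodup)
    (hl : l ∈ Q) (h0 : wordSum V Q = 0) :
    suffixSum Q V l = cond (Q.formPerm l).2 (V (Q.formPerm l).1) (-V (Q.formPerm l).1) +
      suffixSum Q V (Q.formPerm l) := by
  obtain ⟨A, B, h⟩ := List.append_of_mem hl
  -- The word is read cyclically: the last letter is followed by the first, where the vanishing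
  -- total sum is needed.
  rcases B with _ | ⟨m, B⟩
  · rw [suffixSum_of_eq_append V hn h, wordSum_nil]
    rcases hQ : Q with _ | ⟨m, Q'⟩
    · simp [hQ] at hl
    · have hf : (m :: Q').formPerm l = m := by
        have h1 := List.formPerm_apply_getLast m Q'
        have h2 : (m :: Q').getLast (by simp) = l := by
          have h3 := hQ.symm.trans h
          simp only [h3, List.getLast_append, List.getLast_singleton]
          simp
        rwa [h2] at h1
      rw [hf, suffixSum_of_eq_append (Q := m :: Q') (A := []) (B := Q') V (hQ ▸ hn) rfl, ← wordSum_cons, ← hQ, h0]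
  · rw [formPerm_apply_of_eq_append hn h, suffixSum_of_eq_append V hn h,
      suffixSum_of_eq_append (A := A ++ [l]) (B := B) V hn (by simpa using h), wordSum_cons]

/-- The sum between a letter and its inverse is zero, so glued sides of the polygon carry the same
partial sums at matching ends. -/
lemma suffixSum_letterInv {Q : List (Y × Bool)} {V : Y → ℚ} (hQ : IsQuadratic Q) {g : ℕ}
    (h : SurfaceGroup g →* FreeGroup Y) (hh : h (boundary g) = FreeGroup.mk Q)
    (hV : ∀ p, sumHom V (h (FreeGroup.of p)) = 1) {l : Y × Bool} (hl : l ∈ Q) :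
    suffixSum Q V (letterInv l) = cond l.2 (V l.1) (-V l.1) + suffixSum Q V l := by
  have key : ∀ {A B C : List (Y × Bool)} {l : Y × Bool},
      Q = A ++ l :: (B ++ letterInv l :: C) →
      suffixSum Q V (letterInv l) = cond l.2 (V l.1) (-V l.1) + suffixSum Q V l := by
    intro A B C l hs
    have hB : wordSum V B = 0 :=
      wordSum_between_eq_zero (by rw [← hs]; exact hQ.nodup) h (by rw [← hs]; exact hh) hV
    rw [suffixSum_of_eq_append V hQ.nodup hs,
      suffixSum_of_eq_append (A := A ++ l :: B) (B := C) V hQ.nodup (by simpa using hs),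
      wordSum_append, wordSum_cons, hB]
    cases hb : l.2 <;> simp [letterInv, hb]
  obtain ⟨A, B, hs⟩ := List.append_of_mem hl
  have hi := hQ.inv_mem l hl
  rw [hs, List.mem_append, List.mem_cons] at hi
  rcases hi with hi | hi | hi
  · obtain ⟨A, C, rfl⟩ := List.append_of_mem hi
    have := key (A := A) (B := C) (C := B) (l := letterInv l) (by simpa using hs)
    rw [letterInv_letterInv] at this
    rw [this]
    cases hb : l.2 <;> simp [letterInv, hb]
  · exact absurd hi (letterInv_ne l)
  · obtain ⟨C, D, rfl⟩ := List.append_of_mem hi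
    exact key hs

lemma suffixSum_vertexPerm {Q : List (Y × Bool)} {V : Y → ℚ} (hn : Q.Nodup) (hall : ∀ l, l ∈ Q)
    {g : ℕ} (h : SurfaceGroup g →* FreeGroup Y) (hh : h (boundary g) = FreeGroup.mk Q)
    (hV : ∀ p, sumHom V (h (FreeGroup.of p)) = 1) (h0 : wordSum V Q = 0) (l : Y × Bool) :
    suffixSum Q V (vertexPerm Q l) = suffixSum Q V l := by
  have hm : Q.formPerm (vertexPerm Q l) = letterInv l := vertexPerm_eq_iff.1 rfl
  rw [suffixSum_formPerm hn (hall _) h0, hm,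
    suffixSum_letterInv ⟨hn, fun l _ => hall _⟩ h hh hV (hall l)]
  cases hb : l.2 <;> simp [letterInv, hb]

/-- Partial sums turn an admissible weight into a function on the vertices, and differences of
consecutive partial sums recover the weight. So the annihilator, of dimension at least `card Y -
2g`, embeds into functions on a set meeting every vertex. -/
lemma card_le_card_vertices [Fintype Y] {Q : List (Y × Bool)} (hn : Q.Nodup) (hall : ∀ l, l ∈ Q) {g : ℕ}
    (hg : HasRepresentation g (FreeGroup.mk Q)) (S : Finset (Y × Bool))
    (hS : ∀ l, ∃ m ∈ S, (vertexPerm Q).SameCycle l m) :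
    Fintype.card Y ≤ S.card + 2 * g := by
  obtain ⟨h, hh⟩ := hg
  have h1 := le_finrank_annihilator h
  let T : annihilator h →ₗ[ℚ] (S → ℚ) :=
    { toFun := fun V m => suffixSum Q V.1 m
      map_add' := fun V V' => funext fun m => wordSum_add _ _ _
      map_smul' := fun c V => funext fun m => wordSum_smul _ _ _ }
  have hT : Function.Injective T := by
    rw [← LinearMap.ker_eq_bot, LinearMap.ker_eq_bot']
    intro V hV
    have hV' := mem_annihilator.1 V.2
    have h0 : wordSum V.1 Q = 0 := by
      rw [← ofAdd_eq_one, ← sumHom_mk, ← hh]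
      exact map_boundary_eq_one ((sumHom V.1).comp h) fun i => Commute.all _ _
    have hz : ∀ l, suffixSum Q V.1 l = 0 := by
      intro l
      obtain ⟨m, hm, k, hk⟩ := hS l
      have hinv : ∀ (k : ℕ) l, suffixSum Q V.1 ((vertexPerm Q ^ k) l) = suffixSum Q V.1 l := by
        intro k
        induction k with
        | zero => intro l; rfl
        | succ k ih =>
          intro l
          rw [pow_succ', Equiv.Perm.mul_apply, suffixSum_vertexPerm hn hall h hh hV' h0, ih]
      have hzero : suffixSum Q V.1 m = 0 := congrFun hV ⟨m, hm⟩
      rw [← hzero, ← hk]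
      obtain ⟨k, rfl | rfl⟩ := k.eq_nat_or_neg
      · rw [zpow_natCast, hinv]
      · rw [← hinv k ((vertexPerm Q ^ (-(k : ℤ))) l), ← Equiv.Perm.mul_apply, zpow_neg,
          zpow_natCast, mul_inv_cancel, Equiv.Perm.one_apply]
    ext y
    have h2 := suffixSum_formPerm (V := V.1) (l := Q.formPerm⁻¹ (y, true)) hn (hall _) h0
    rw [hz, hz, ← Equiv.Perm.mul_apply, mul_inv_cancel, Equiv.Perm.one_apply] at h2
    simpa using h2.symm
  have h2 := LinearMap.finrank_le_finrank_of_injective hT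
  rw [Module.finrank_fintype_fun_eq_card, Fintype.card_coe] at h2
  omega

/-- All but boundedly many corners of a quadratic word of bounded genus lie at vertices of degree at
most two. -/
theorem card_vertexPerm_sq_ne_le [Fintype Y] {Q : List (Y × Bool)} (hn : Q.Nodup)
    (hall : ∀ l, l ∈ Q) {g : ℕ} (hg : HasRepresentation g (FreeGroup.mk Q)) :
    {l | vertexPerm Q (vertexPerm Q l) ≠ l}.ncard ≤
      12 * g + 3 * {l | vertexPerm Q l = l}.ncard := by
  classical
  set σ := vertexPerm Q
  let s := Equiv.Perm.SameCycle.setoid σ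
  let S : Finset (Y × Bool) := Finset.univ.image (Quotient.out : Quotient s → Y × Bool)
  have hS : ∀ l, ∃ m ∈ S, σ.SameCycle l m := by
    intro l
    refine ⟨(Quotient.mk s l).out, by simp [S], ?_⟩
    exact (Quotient.exact (Quotient.out_eq (Quotient.mk s l))).symm
  have h1 := card_le_card_vertices hn hall hg S hS
  have hScard : S.card ≤ Fintype.card (Quotient s) := Finset.card_image_le
  -- Weights chosen so that every cycle has total at least 6, whatever its length. They differ from
  -- the constant 3 by `+3` at fixed corners and by `-1` at corners of degree at least three.
  let w : Y × Bool → ℕ := fun l => if σ l = l then 6 else if σ (σ l) = l then 3 else 2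
  have hfib : ∀ o : Quotient s, 6 ≤ ∑ l with Quotient.mk s l = o, w l := by
    intro o
    obtain ⟨l, rfl⟩ := Quotient.exists_rep o
    have hmem : ∀ k : ℕ, Quotient.mk s ((σ ^ k) l) = Quotient.mk s l := by
      intro k
      exact Quotient.sound (Equiv.Perm.SameCycle.symm ⟨k, by simp⟩)
    have hm0 : Quotient.mk s l = Quotient.mk s l := rfl
    have hm1 : Quotient.mk s (σ l) = Quotient.mk s l := hmem 1
    have hm2 : Quotient.mk s (σ (σ l)) = Quotient.mk s l := hmem 2
    have hsub : ∀ T : Finset (Y × Bool), (∀ m ∈ T, Quotient.mk s m = Quotient.mk s l) →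
        ∑ m ∈ T, w m ≤ ∑ m with Quotient.mk s m = Quotient.mk s l, w m := by
      intro T hT
      exact Finset.sum_le_sum_of_subset fun m hm => by simpa using hT m hm
    have hw2 : ∀ m, 2 ≤ w m := by
      intro m
      simp only [w]
      split_ifs <;> omega
    by_cases hf : σ l = l
    · refine le_trans ?_ (hsub {l} (by simp))
      simp [w, hf]
    by_cases hf2 : σ (σ l) = l
    · refine le_trans ?_ (hsub {l, σ l} (by simp [hm1]))
      rw [Finset.sum_pair (Ne.symm hf)]
      simp [w, hf, hf2, Ne.symm hf]
    · refine le_trans ?_ (hsub {l, σ l, σ (σ l)} (by simp [hm1, hm2]))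
      rw [Finset.sum_insert, Finset.sum_pair]
      · have := hw2 l
        have := hw2 (σ l)
        have := hw2 (σ (σ l))
        omega
      · intro h
        exact hf (σ.injective h).symm
      · simp only [Finset.mem_insert, Finset.mem_singleton, not_or]
        exact ⟨Ne.symm hf, Ne.symm hf2⟩
  have h2 : 6 * Fintype.card (Quotient s) ≤ ∑ l, w l := by
    rw [← Finset.sum_fiberwise (g := fun l => Quotient.mk s l), mul_comm, ← smul_eq_mul,
      ← Finset.card_univ, ← Finset.sum_const]
    exact Finset.sum_le_sum fun o _ => hfib o
  have h3 : ∑ l, w l + ∑ l, (if σ (σ l) ≠ l then 1 else 0) =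
      ∑ _l : Y × Bool, 3 + 3 * ∑ l, (if σ l = l then 1 else 0) := by
    rw [← Finset.sum_add_distrib, Finset.mul_sum, ← Finset.sum_add_distrib]
    refine Finset.sum_congr rfl fun l _ => ?_
    simp only [w]
    by_cases hf : σ l = l
    · simp [hf]
    · by_cases hf2 : σ (σ l) = l <;> simp [hf, hf2]
  rw [← Finset.card_filter, ← Finset.card_filter, Finset.sum_const, smul_eq_mul, Finset.card_univ,
    Fintype.card_prod, Fintype.card_bool] at h3
  rw [Set.ncard_eq_toFinset_card', Set.ncard_eq_toFinset_card', Set.toFinset_ofPred,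
    Set.toFinset_ofPred]
  omega

end VertexCount


/-! ### Words with recognizable subwords, and substitution -/

section Marking

/-- Killing the generators that do not occur leaves the word unchanged; the vertex count needs a
finite alphabet all of whose letters are used. -/
lemma HasPairing.exists_full {X : Type*} {g : ℕ} {L : List (X × Bool)} (h : HasPairing g L) :
    ∃ (Y : Type) (_ : Finite Y) (lam : Y → X) (Q : List (Y × Bool)), Q.Nodup ∧ (∀ l, l ∈ Q) ∧
      Q.map (Prod.map lam id) = L ∧ HasRepresentation g (FreeGroup.mk Q) := by
  classical
  obtain ⟨Y, lam, Q, hQ, hL, hg⟩ := h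
  have hmem : ∀ l ∈ Q, (l.1, true) ∈ Q := by
    rintro ⟨y, b⟩ hl
    cases b
    · exact hQ.inv_mem _ hl
    · exact hl
  let Y' := {y // (y, true) ∈ Q}
  let Q' : List (Y' × Bool) := Q.attach.map fun l => (⟨l.1.1, hmem l.1 l.2⟩, l.1.2)
  have hQ' : Q'.map (Prod.map Subtype.val id) = Q := by
    rw [List.map_map]
    exact List.attach_map_subtype_val Q
  refine ⟨Y', ?_, lam ∘ Subtype.val, Q', ?_, ?_, ?_, ?_⟩
  · refine Set.Finite.subset (Finset.finite_toSet (Q.map Prod.fst).toFinset) fun y hy => ?_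
    simp only [Finset.mem_coe, List.mem_toFinset, List.mem_map]
    exact ⟨_, hy, rfl⟩
  · refine List.Nodup.of_map (Prod.map Subtype.val id) ?_
    rw [hQ']
    exact hQ.nodup
  · rintro ⟨⟨y, hy⟩, b⟩
    have hb : (y, b) ∈ Q := by
      cases b
      · exact hQ.inv_mem _ hy
      · exact hy
    exact List.mem_map.2 ⟨⟨_, hb⟩, List.mem_attach _ _, rfl⟩
  · have := congrArg (List.map (Prod.map lam id)) hQ'
    rw [List.map_map, hL] at this
    exact this
  · let F : FreeGroup Y →* FreeGroup Y' :=
      FreeGroup.lift fun y => if h : (y, true) ∈ Q then FreeGroup.of ⟨y, h⟩ else 1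
    have hF : F.comp (FreeGroup.map Subtype.val) = MonoidHom.id (FreeGroup Y') := by
      ext ⟨y, hy⟩
      simp only [F, MonoidHom.comp_apply, FreeGroup.map.of, FreeGroup.lift_apply_of, hy, dite_true]
      rfl
    have h2 := DFunLike.congr_fun hF (FreeGroup.mk Q')
    rw [MonoidHom.comp_apply, FreeGroup.map.mk] at h2
    change F (FreeGroup.mk (Q'.map (Prod.map Subtype.val id))) = FreeGroup.mk Q' at h2
    rw [hQ'] at h2
    rw [← h2]
    exact hg.map F

/-- Each word `W i` has `M` disjoint subwords, the `k`-th of which starts with the letter `x` at the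
position `p i k` and has `d i k + 2` letters, that are recognizable. -/
structure IsMarking {X I : Type*} (W : I → List (X × Bool)) (M : ℕ) (p d : I → ℕ → ℕ) (x : X) :
    Prop where
  reduced : ∀ i, FreeGroup.IsReduced (W i)
  pos : ∀ i k, k < M → (W i)[p i k]? = some (x, true)
  no_inv : ∀ i, (x, false) ∉ W i
  lt_length : ∀ i k, k < M → p i k + d i k + 1 < (W i).length
  -- The bound is `d i k`, not `d i k + 1`: only the corners have to be disjoint, so the last letter
  -- of one subword may be the first of the next.
  disjoint : ∀ i k k' s s', k < M → k' < M → s ≤ d i k → s' ≤ d i k' →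
    p i k + s = p i k' + s' → k = k'
  -- Letters beyond the end of `W i'` are not compared, since a match in a pairing may run off the
  -- end of a block. Recognition must exclude this too.
  recog : ∀ i k, k < M → ∀ i' p', p' < (W i').length →
    (∀ s ≤ d i k + 1, ∀ c ∈ (W i')[p' + s]?, (W i)[p i k + s]? = some c) → i' = i ∧ p' = p i k

/-- The positions of the letters in `substWord W z`. -/
abbrev Position {X I : Type*} (W : I → List (X × Bool)) (z : List (I × Bool)) : Type :=
  Σ t : Fin z.length, Fin (W z[t].1).length

variable {X I : Type*} (W : I → List (X × Bool)) (z : List (I × Bool))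

/-- The positions within the subword that replaces the letter with index `t`, in order. -/
def positionsAt (t : Fin z.length) : List (Position W z) :=
  (cond z[t].2 (List.finRange (W z[t].1).length) (List.finRange (W z[t].1).length).reverse).map
    (Sigma.mk t)

/-- All positions, in order. -/
def positions : List (Position W z) :=
  (List.finRange z.length).flatMap (positionsAt W z)

/-- The letter at a position. -/
def letterAt (d : Position W z) : X × Bool :=
  cond z[d.1].2 (W z[d.1].1)[d.2] (letterInv (W z[d.1].1)[d.2])

lemma nodup_positionsAt (t : Fin z.length) : (positionsAt W z t).Nodup := by
  refine List.Nodup.map sigma_mk_injective ?_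
  cases z[t].2
  · exact List.nodup_reverse.2 (List.nodup_finRange _)
  · exact List.nodup_finRange _

lemma mem_positionsAt {t : Fin z.length} {d : Position W z} :
    d ∈ positionsAt W z t ↔ d.1 = t := by
  rcases d with ⟨t', c⟩
  rw [positionsAt, List.mem_map]
  constructor
  · rintro ⟨c', -, h⟩
    cases h
    rfl
  · rintro rfl
    refine ⟨c, ?_, rfl⟩
    change c ∈ cond z[t'].2 _ _
    cases z[t'].2 <;> simp

lemma nodup_positions : (positions W z).Nodup := by
  rw [positions, List.nodup_flatMap]
  refine ⟨fun t _ => nodup_positionsAt W z t, (List.nodup_finRange _).imp ?_⟩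
  intro t t' hne d hd hd'
  rw [mem_positionsAt] at hd hd'
  exact hne (hd.symm.trans hd')

lemma mem_positions (d : Position W z) : d ∈ positions W z :=
  List.mem_flatMap.2 ⟨d.1, List.mem_finRange _, (mem_positionsAt W z).2 rfl⟩

lemma positions_map_letterAt : (positions W z).map (letterAt W z) = substWord W z := by
  have hz : (List.finRange z.length).map (fun t => z[t]) = z := by
    refine List.ext_getElem (by simp) fun i h1 h2 => ?_
    simp
  have h2 : substWord W z = (List.finRange z.length).flatMap fun t =>
      cond z[t].2 (W z[t].1) (FreeGroup.invRev (W z[t].1)) := by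
    conv_lhs => rw [← hz]
    rw [substWord, List.flatMap_map]
  rw [h2, positions, List.map_flatMap]
  congr 1
  funext t
  have hw : (List.finRange (W z[t].1).length).map (fun c => (W z[t].1)[c]) = W z[t].1 := by
    refine List.ext_getElem (by simp) fun i h1 h2 => ?_
    simp
  rw [positionsAt, List.map_map]
  cases hb : z[t].2
  · rw [cond_false, cond_false, FreeGroup.invRev, List.map_reverse]
    conv_rhs => rw [← hw]
    rw [List.map_map]
    congr 1
    refine List.map_congr_left fun c _ => ?_
    simp only [Function.comp_apply, letterAt]
    rw [hb]
    rfl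
  · rw [cond_true, cond_true]
    conv_rhs => rw [← hw]
    refine List.map_congr_left fun c _ => ?_
    simp only [Function.comp_apply, letterAt]
    rw [hb]
    rfl

lemma pair_infix_of_getElem {α : Type*} (l : List α) (i : ℕ) (h : i + 1 < l.length) :
    ∃ A B, l = A ++ l[i] :: l[i + 1] :: B := by
  refine ⟨l.take i, l.drop (i + 2), ?_⟩
  conv_lhs => rw [← List.take_append_drop i l, List.drop_eq_getElem_cons (by omega),
    List.drop_eq_getElem_cons h]

/-- In the block of an inverse letter the word is read backwards, so there position `c + 1` comes
just before position `c`. -/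
lemma exists_positions_eq (t : Fin z.length) (c : ℕ) (h : c + 1 < (W z[t].1).length) :
    ∃ A B, positions W z = A ++
      cond z[t].2 (⟨t, ⟨c, by omega⟩⟩ : Position W z) ⟨t, ⟨c + 1, h⟩⟩ ::
      cond z[t].2 (⟨t, ⟨c + 1, h⟩⟩ : Position W z) ⟨t, ⟨c, by omega⟩⟩ :: B := by
  obtain ⟨S, T, hST⟩ := List.append_of_mem (List.mem_finRange t)
  obtain ⟨A, B, hAB⟩ := pair_infix_of_getElem (List.finRange (W z[t].1).length) c (by simpa using h)
  rw [List.getElem_finRange, List.getElem_finRange] at hAB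
  have h3 : ∃ A' B', positionsAt W z t = A' ++
      cond z[t].2 (⟨t, ⟨c, by omega⟩⟩ : Position W z) ⟨t, ⟨c + 1, h⟩⟩ ::
      cond z[t].2 (⟨t, ⟨c + 1, h⟩⟩ : Position W z) ⟨t, ⟨c, by omega⟩⟩ :: B' := by
    rw [positionsAt, hAB]
    cases z[t].2
    · refine ⟨B.reverse.map (Sigma.mk t), A.reverse.map (Sigma.mk t), ?_⟩
      simp
    · refine ⟨A.map (Sigma.mk t), B.map (Sigma.mk t), ?_⟩
      simp
  obtain ⟨A', B', h4⟩ := h3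
  refine ⟨S.flatMap (positionsAt W z) ++ A', B' ++ T.flatMap (positionsAt W z), ?_⟩
  rw [positions, hST, List.flatMap_append, List.flatMap_cons, h4]
  simp

/-- A quadratic word in which all letters occur, read at the positions of `substWord W z`. -/
lemma exists_positionEquiv {Y : Type*} (lam : Y → X) {Q : List (Y × Bool)} (hn : Q.Nodup)
    (hall : ∀ l, l ∈ Q) (hL : Q.map (Prod.map lam id) = substWord W z) :
    ∃ q : Position W z ≃ Y × Bool, (positions W z).map q = Q ∧
      ∀ d, Prod.map lam id (q d) = letterAt W z d := by
  classical
  have hlen : (positions W z).length = Q.length := by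
    have := congrArg List.length (hL.trans (positions_map_letterAt W z).symm)
    simpa using this.symm
  let e₁ := (nodup_positions W z).getEquivOfForallMemList _ (mem_positions W z)
  let e₂ := hn.getEquivOfForallMemList _ hall
  let q := e₁.symm.trans ((finCongr hlen).trans e₂)
  have hq : (positions W z).map q = Q := by
    refine List.ext_getElem (by simpa using hlen) fun i h1 h2 => ?_
    rw [List.length_map] at h1
    rw [List.getElem_map]
    have h3 : (positions W z)[i] = e₁ ⟨i, h1⟩ := rfl
    rw [h3]
    simp only [q, Equiv.trans_apply, Equiv.symm_apply_apply]
    rfl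
  refine ⟨q, hq, fun d => ?_⟩
  have h4 : (positions W z).map (fun d => Prod.map lam id (q d)) =
      (positions W z).map (letterAt W z) := by
    rw [positions_map_letterAt, ← hL]
    conv_rhs => rw [← hq]
    rw [List.map_map]
    rfl
  exact List.map_inj_left.1 h4 d (mem_positions W z d)

variable {W z}

/-- A fixed corner is a letter followed by its own inverse. Blocks are reduced, so this happens only
at the position of a block that is read last, at most once per letter of `z`. -/
lemma ncard_vertexPerm_fixed_le {Y : Type*} [DecidableEq Y] {lam : Y → X} {Q : List (Y × Bool)}
    (hn : Q.Nodup) {q : Position W z ≃ Y × Bool} (hq : (positions W z).map q = Q)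
    (hlam : ∀ d, Prod.map lam id (q d) = letterAt W z d)
    (hW : ∀ i, FreeGroup.IsReduced (W i)) :
    {l | vertexPerm Q l = l}.ncard ≤ z.length := by
  have hkey : ∀ d : Position W z, vertexPerm Q (q d) = q d →
      d.2.1 = cond z[d.1].2 ((W z[d.1].1).length - 1) 0 := by
    rintro ⟨t, ⟨c, hc⟩⟩ hd
    rw [vertexPerm_eq_iff] at hd
    have hcontra : ∀ c (h : c + 1 < (W z[t].1).length), (W z[t].1)[c] = letterInv (W z[t].1)[c + 1] →
        False := by
      intro c h he
      have h1 := List.isChain_iff_getElem.1 (hW z[t].1) c h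
      rw [he] at h1
      simp [letterInv] at h1
    have hadj : ∀ c (h : c + 1 < (W z[t].1).length), _ := exists_positions_eq W z t
    change c = cond z[t].2 _ _
    cases hb : z[t].2
    · rw [cond_false]
      by_contra hne
      obtain ⟨c, rfl⟩ : ∃ c', c = c' + 1 := ⟨c - 1, by omega⟩
      obtain ⟨A, B, h⟩ := hadj c hc
      rw [hb] at h
      have h2 := formPerm_apply_of_eq_append (A := A.map q) (B := B.map q) hn
        (by rw [← hq, h, List.map_append, List.map_cons, List.map_cons])
      rw [cond_false, cond_false, hd] at h2
      have h3 := congrArg (Prod.map lam id) h2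
      have h4 : Prod.map lam id (letterInv (q ⟨t, ⟨c + 1, hc⟩⟩)) =
        letterInv (Prod.map lam id (q ⟨t, ⟨c + 1, hc⟩⟩)) := rfl
      rw [h4, hlam, hlam, letterAt, letterAt] at h3
      simp only [hb, cond_false] at h3
      refine hcontra c hc ?_
      exact (letterInv_injective h3).symm
    · rw [cond_true]
      by_contra hne
      have hc' : c + 1 < (W z[t].1).length := by
        change ¬c = (W z[t].1).length - 1 at hne
        omega
      obtain ⟨A, B, h⟩ := hadj c hc'
      rw [hb] at h
      have h2 := formPerm_apply_of_eq_append (A := A.map q) (B := B.map q) hn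
        (by rw [← hq, h, List.map_append, List.map_cons, List.map_cons])
      rw [cond_true, cond_true, hd] at h2
      have h3 := congrArg (Prod.map lam id) h2
      have h4 : Prod.map lam id (letterInv (q ⟨t, ⟨c, hc⟩⟩)) =
        letterInv (Prod.map lam id (q ⟨t, ⟨c, hc⟩⟩)) := rfl
      rw [h4, hlam, hlam, letterAt, letterAt] at h3
      simp only [hb, cond_true] at h3
      refine hcontra c hc' ?_
      have h5 := congrArg letterInv h3
      rw [letterInv_letterInv] at h5
      exact h5
  have h1 : {l | vertexPerm Q l = l}.ncard ≤ (Set.univ : Set (Fin z.length)).ncard := by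
    refine Set.ncard_le_ncard_of_injOn (fun l => (q.symm l).1) (fun _ _ => Set.mem_univ _) ?_
    intro l hl l' hl' he
    obtain ⟨⟨t, c⟩, rfl⟩ := q.surjective l
    obtain ⟨⟨t', c'⟩, rfl⟩ := q.surjective l'
    simp only [Equiv.symm_apply_apply] at he
    subst he
    have h1 := hkey _ hl
    have h2 := hkey _ hl'
    congr 2
    exact Fin.ext (h1.trans h2.symm)
  simpa [Set.ncard_univ] using h1

/-- The corner between two consecutive positions is the letter that is read first. -/
def cornerAt {Y : Type*} (q : Position W z ≃ Y × Bool) (t : Fin z.length) (c : ℕ)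
    (h : c + 1 < (W z[t].1).length) : Y × Bool :=
  cond z[t].2 (q ⟨t, ⟨c, by omega⟩⟩) (q ⟨t, ⟨c + 1, h⟩⟩)

lemma cornerAt_inj {Y : Type*} {q : Position W z ≃ Y × Bool} {t t' : Fin z.length} {c c' : ℕ}
    {h : c + 1 < (W z[t].1).length} {h' : c' + 1 < (W z[t'].1).length}
    (he : cornerAt q t c h = cornerAt q t' c' h') : t = t' ∧ c = c' := by
  have h1 : ∀ (t : Fin z.length) (c : ℕ) (h : c + 1 < (W z[t].1).length),
      (q.symm (cornerAt q t c h)).1 = t := by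
    intro t c h
    rw [cornerAt]
    cases z[t].2 <;> simp
  have ht : t = t' := by rw [← h1 t c h, he, h1]
  subst ht
  refine ⟨rfl, ?_⟩
  rw [cornerAt, cornerAt] at he
  cases hb : z[t].2 <;> rw [hb] at he <;> simpa using he

/-- At a corner of degree at most two the gluing continues: if `m` follows `l`, the inverse of `l`
follows the inverse of `m`. -/
lemma letterInv_step {Y : Type*} [DecidableEq Y] {Q : List (Y × Bool)} {l m : Y × Bool}
    (h : Q.formPerm l = m) (hl : vertexPerm Q (vertexPerm Q l) = l) :
    Q.formPerm (letterInv m) = letterInv l := by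
  have h1 : Q.formPerm (vertexPerm Q l) = letterInv l := vertexPerm_eq_iff.1 rfl
  have h2 := vertexPerm_eq_iff.1 hl
  rw [h] at h2
  rwa [h2, letterInv_letterInv]

lemma formPerm_position {Y : Type*} [DecidableEq Y] {Q : List (Y × Bool)} (hn : Q.Nodup)
    {q : Position W z ≃ Y × Bool} (hq : (positions W z).map q = Q) (t : Fin z.length) (c : ℕ)
    (h : c + 1 < (W z[t].1).length) :
    Q.formPerm (cond z[t].2 (q ⟨t, ⟨c, by omega⟩⟩) (q ⟨t, ⟨c + 1, h⟩⟩)) =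
      cond z[t].2 (q ⟨t, ⟨c + 1, h⟩⟩) (q ⟨t, ⟨c, by omega⟩⟩) := by
  obtain ⟨A, B, hs⟩ := exists_positions_eq W z t c h
  refine formPerm_apply_of_eq_append (A := A.map q) (B := B.map q) hn ?_
  rw [← hq, hs, List.map_append, List.map_cons, List.map_cons]
  cases z[t].2 <;> rfl

/-- If all corners within a marked subword are unbroken, then the inverse of its first letter is the
first letter of the inverse of the same marked subword. -/
lemma letterInv_position {Y : Type*} [DecidableEq Y] {lam : Y → X} {Q : List (Y × Bool)}
    (hn : Q.Nodup) {q : Position W z ≃ Y × Bool} (hq : (positions W z).map q = Q)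
    (hlam : ∀ d, Prod.map lam id (q d) = letterAt W z d) {M : ℕ} {p d : I → ℕ → ℕ} {x : X}
    (hW : IsMarking W M p d x) (t : Fin z.length) {k : ℕ} (hk : k < M)
    (hgood : ∀ s ≤ d z[t].1 k, ∀ h : p z[t].1 k + s + 1 < (W z[t].1).length,
      vertexPerm Q (vertexPerm Q (cornerAt q t _ h)) = cornerAt q t _ h)
    (hp : p z[t].1 k < (W z[t].1).length) (e : Position W z)
    (he : q e = letterInv (q ⟨t, ⟨p z[t].1 k, hp⟩⟩)) :
    z[e.1].1 = z[t].1 ∧ e.2.1 = p z[t].1 k := by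
  obtain ⟨t', ⟨c', hc'⟩⟩ := e
  have hlen := hW.lt_length z[t].1 k hk
  have hx : (W z[t].1)[p z[t].1 k] = (x, true) := by
    have := hW.pos z[t].1 k hk
    rw [List.getElem?_eq_getElem hp] at this
    exact Option.some.inj this
  have hlab : ∀ {e e' : Position W z}, q e = letterInv (q e') →
      letterAt W z e = letterInv (letterAt W z e') := by
    intro e e' h
    rw [← hlam, ← hlam, h]
    rfl
  -- Since `(x, false)` occurs in no `W i`, the partner of a marked `x` lies in a block of opposite
  -- orientation.
  have hsign : z[t'].2 = !z[t].2 := by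
    have h1 := hlab he
    simp only [letterAt] at h1
    by_contra hne
    have heq : z[t'].2 = z[t].2 := by
      revert hne
      cases z[t'].2 <;> cases z[t].2 <;> simp
    have h2 : (W z[t'].1)[c'] = (x, false) := by
      have hx' : (W z[(t : ℕ)].1)[p z[(t : ℕ)].1 k] = (x, true) := hx
      simp only [Fin.getElem_fin] at h1 heq
      rw [heq, hx'] at h1
      revert h1
      cases z[(t : ℕ)].2
      · intro h1
        simp only [cond_false] at h1
        exact letterInv_injective h1
      · intro h1
        simpa [letterInv] using h1
    exact hW.no_inv _ (h2 ▸ List.getElem_mem _)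
  -- Unbroken corners let the two blocks be followed in parallel, one letter at a time, until one of
  -- them ends.
  have hwalk : ∀ s ≤ d z[t].1 k + 1, ∀ (h' : c' + s < (W z[t'].1).length)
      (h : p z[t].1 k + s < (W z[t].1).length),
      q ⟨t', ⟨c' + s, h'⟩⟩ = letterInv (q ⟨t, ⟨p z[t].1 k + s, h⟩⟩) := by
    intro s
    induction s with
    | zero => intro _ _ _; exact he
    | succ s ih =>
      intro hs h' h
      have ih' := ih (by omega) (by omega) (by omega)
      have h1 := hgood s (by omega) (by omega)
      have h2 := formPerm_position hn hq t (p z[t].1 k + s) h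
      have h3 := formPerm_position hn hq t' (c' + s) h'
      rw [cornerAt] at h1
      have h4 := letterInv_step h2 h1
      rw [hsign] at h3
      cases hb : z[t].2
      · rw [hb] at h3 h4
        simp only [cond_false, cond_true, Bool.not_false] at h3 h4
        rw [ih', h4] at h3
        exact h3.symm
      · rw [hb] at h3 h4
        simp only [cond_false, cond_true, Bool.not_true] at h3 h4
        rw [ih', ← h4] at h3
        exact Q.formPerm.injective h3
  have hfin := hW.recog z[t].1 k hk z[t'].1 c' hc' ?_
  · exact hfin
  · intro s hs c hc
    rw [Option.mem_def, List.getElem?_eq_some_iff] at hc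
    obtain ⟨h', rfl⟩ := hc
    have h : p z[t].1 k + s < (W z[t].1).length := by omega
    rw [List.getElem?_eq_getElem h]
    have h1 := hlab (hwalk s hs h' h)
    simp only [letterAt] at h1
    congr 1
    rw [hsign] at h1
    revert h1
    cases z[t].2
    · intro h1
      exact (h1.trans (letterInv_letterInv _)).symm
    · intro h1
      exact (letterInv_injective h1).symm

/-- Pigeonhole: if each of the `M` marked subwords were broken in some occurrence of `W i`, the
broken corners would be `M` distinct ones. -/
lemma exists_unbroken {Y : Type*} [DecidableEq Y] [Finite Y] {Q : List (Y × Bool)}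
    (q : Position W z ≃ Y × Bool) {M : ℕ} {p d : I → ℕ → ℕ} {x : X}
    (hW : IsMarking W M p d x)
    (hM : {l | vertexPerm Q (vertexPerm Q l) ≠ l}.ncard < M) (i : I) :
    ∃ k < M, ∀ t : Fin z.length, z[t].1 = i → ∀ s ≤ d z[t].1 k,
      ∀ h : p z[t].1 k + s + 1 < (W z[t].1).length,
      vertexPerm Q (vertexPerm Q (cornerAt q t _ h)) = cornerAt q t _ h := by
  by_contra! hcon
  choose! t ht s hs h hbad using fun k : Fin M => hcon k.1 k.2
  have hinj : Function.Injective fun k : Fin M => cornerAt q (t k) _ (h k) := by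
    intro k k' he
    obtain ⟨h1, h2⟩ := cornerAt_inj he
    refine Fin.ext (hW.disjoint i k k' (s k) (s k') k.2 k'.2 ?_ ?_ ?_)
    · rw [← ht k]
      exact hs k
    · rw [← ht k']
      exact hs k'
    · rw [ht k, ht k'] at h2
      exact h2
  have h1 : (Set.range fun k : Fin M => cornerAt q (t k) _ (h k)).ncard = M := by
    rw [← Set.image_univ, Set.ncard_image_of_injective _ hinj, Set.ncard_univ, Nat.card_fin]
  have h2 := Set.ncard_le_ncard (s := Set.range fun k : Fin M => cornerAt q (t k) _ (h k))
    (t := {l | vertexPerm Q (vertexPerm Q l) ≠ l}) (by rintro _ ⟨k, rfl⟩; exact hbad k)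
    (Set.toFinite _)
  omega

end Marking


/-! ### Recovering a pairing of the original word -/

section Marking

variable {X I : Type*} {W : I → List (X × Bool)} {z : List (I × Bool)}

lemma filter_eq_singleton {α : Type*} {l : List α} {P : α → Bool} {a : α} (hn : l.Nodup)
    (ha : a ∈ l) (hP : ∀ b ∈ l, P b = true ↔ b = a) : l.filter P = [a] := by
  classical
  have h1 : l.filter P = l.filter (fun b => b = a) := by
    refine List.filter_congr fun b hb => ?_
    rw [Bool.eq_iff_iff, hP b hb, decide_eq_true_iff]
  rw [h1, List.filter_eq, List.count_eq_one_of_mem hn ha]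
  rfl

lemma mk_filter_eq {Y : Type*} (Q : List (Y × Bool)) (P : Y × Bool → Prop) [DecidablePred P]
    (hP : ∀ l, P l → P (letterInv l)) :
    FreeGroup.lift (fun y => if P (y, true) then FreeGroup.of y else 1) (FreeGroup.mk Q) =
      FreeGroup.mk (Q.filter P) := by
  induction Q with
  | nil => rw [List.filter_nil, ← FreeGroup.one_eq_mk, map_one]
  | cons l Q ih =>
    rw [mk_cons', map_mul, ih]
    have hl : P l ↔ P (l.1, true) := by
      rcases l with ⟨y, b⟩
      cases b
      · exact ⟨hP (y, false), hP (y, true)⟩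
      · rfl
    by_cases h : P l
    · rw [List.filter_cons_of_pos (by simpa using h), mk_cons' l (Q.filter P)]
      refine congrArg (· * FreeGroup.mk (Q.filter P)) ?_
      refine lift_mk_singleton _ _ _ ?_
      rw [if_pos (hl.1 h)]
      rcases l with ⟨y, b⟩
      cases b
      · simp [FreeGroup.inv_mk, FreeGroup.invRev, FreeGroup.of]
      · rfl
    · rw [List.filter_cons_of_neg (by simpa using h)]
      refine (congrArg (· * FreeGroup.mk (Q.filter P)) ?_).trans (one_mul _)
      refine lift_mk_singleton _ _ _ ?_
      rw [if_neg fun h' => h (hl.2 h')]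
      cases l.2 <;> simp

/-- The genus does not drop when sufficiently long, generic words are substituted for the letters
of a word. -/
theorem HasPairing.of_substWord {g M : ℕ} {p d : I → ℕ → ℕ} {x : X} (hW : IsMarking W M p d x)
    (hM : 12 * g + 3 * z.length < M) (h : HasPairing g (substWord W z)) : HasPairing g z := by
  classical
  obtain ⟨Y, hY, lam, Q, hn, hall, hL, hg⟩ := h.exists_full
  have := Fintype.ofFinite Y
  obtain ⟨q, hq, hlam⟩ := exists_positionEquiv W z lam hn hall hL
  have h1 := card_vertexPerm_sq_ne_le hn hall hg
  have h2 := ncard_vertexPerm_fixed_le hn hq hlam hW.reduced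
  choose k hk hgood using exists_unbroken q hW (Q := Q) (by omega)
  have hlen : ∀ i, p i (k i) < (W i).length := fun i => by
    have := hW.lt_length i (k i) (hk i)
    omega
  let c : ∀ t : Fin z.length, Position W z := fun t => ⟨t, ⟨p z[t].1 (k z[t].1), hlen _⟩⟩
  -- Keep one letter per block, the first letter of its unbroken marked subword. The subword depends
  -- only on the substituted word, so paired blocks select matching letters and the kept set is
  -- closed under inversion.
  let P : Y × Bool → Prop := fun l => ∃ t, l = q (c t)
  have hPinv : ∀ t, ∃ t', letterInv (q (c t)) = q (c t') ∧ z[t'].1 = z[t].1 := by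
    intro t
    obtain ⟨e, he⟩ := q.surjective (letterInv (q (c t)))
    obtain ⟨h3, h4⟩ := letterInv_position hn hq hlam hW t (hk z[t].1)
      (hgood z[t].1 t rfl) (hlen _) e he
    refine ⟨e.1, ?_, h3⟩
    rw [← he]
    congr 1
    obtain ⟨t', c', hc'⟩ := e
    simp only [c]
    congr 2
    simp only at h3 h4
    rw [h4, h3]
  have hP : ∀ l, P l → P (letterInv l) := by
    rintro _ ⟨t, rfl⟩
    obtain ⟨t', ht', -⟩ := hPinv t
    exact ⟨t', ht'⟩
  have hfilter : Q.filter P = (List.finRange z.length).map fun t => q (c t) := by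
    have h3 : (positions W z).filter (fun e => decide (P (q e))) = (List.finRange z.length).map c := by
      rw [positions, List.filter_flatMap, ← List.flatMap_singleton' ((List.finRange z.length).map c),
        List.flatMap_map]
      congr 1
      funext t
      refine filter_eq_singleton (nodup_positionsAt W z t) ((mem_positionsAt W z).2 rfl) ?_
      intro e he
      rw [mem_positionsAt] at he
      rw [decide_eq_true_iff]
      constructor
      · rintro ⟨t', ht'⟩
        have h4 := q.injective ht'
        rw [h4] at he
        rw [h4, ← he]
      · rintro rfl
        exact ⟨t, rfl⟩
    conv_lhs => rw [← hq]
    rw [List.filter_map]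
    have h4 := congrArg (List.map q) h3
    rw [List.map_map] at h4
    exact h4
  -- A kept generator is labelled by the letter of `z` whose block contains its positive occurrence;
  -- by `hPinv` the negative occurrence gives the same label.
  refine ⟨Y, fun y => z[(q.symm (y, true)).1].1, Q.filter P, ⟨hn.filter _, ?_⟩, ?_, ?_⟩
  · intro l hl
    rw [List.mem_filter, decide_eq_true_iff] at hl ⊢
    exact ⟨hall _, hP l hl.2⟩
  · rw [hfilter, List.map_map]
    refine List.ext_getElem (by simp) fun j h3 h4 => ?_
    simp only [List.getElem_map, List.getElem_finRange, Function.comp_apply]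
    set t : Fin z.length := ⟨j, h4⟩
    have hx : (W z[t].1)[p z[t].1 (k z[t].1)]'(hlen _) = (x, true) := by
      have := hW.pos z[t].1 _ (hk z[t].1)
      rw [List.getElem?_eq_getElem (hlen _)] at this
      exact Option.some.inj this
    have h5 := congrArg Prod.snd (hlam (c t))
    have h6 : (letterAt W z (c t)).2 = z[t].2 := by
      have : letterAt W z (c t) = cond z[t].2 ((W z[t].1)[p z[t].1 (k z[t].1)]'(hlen _))
        (letterInv ((W z[t].1)[p z[t].1 (k z[t].1)]'(hlen _))) := rfl
      rw [this, hx]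
      cases z[t].2 <;> rfl
    rw [h6] at h5
    have h7 : (q (c t)).2 = z[t].2 := h5
    have hz : ∀ t₁ t₂ : Fin z.length, t₁ = t₂ → z[t₁].1 = z[t₂].1 := by
      rintro _ _ rfl
      rfl
    refine Prod.ext ?_ h7
    change z[(q.symm ((q (c t)).1, true)).1].1 = z[t].1
    cases hb : (q (c t)).2
    · obtain ⟨t', h8, h9⟩ := hPinv t
      have h10 : ((q (c t)).1, true) = q (c t') := by
        rw [← h8, letterInv, hb]
        rfl
      exact (hz _ t' (by rw [h10, Equiv.symm_apply_apply])).trans h9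
    · have h10 : ((q (c t)).1, true) = q (c t) := by rw [← hb]
      exact hz _ t (by rw [h10, Equiv.symm_apply_apply])
  · rw [← mk_filter_eq Q P hP]
    exact hg.map _

end Marking


/-! ### The code words -/

section Code

variable {X : Type*} (a b : X) (M : ℕ)

/-- The exponents that occur in the code words. -/
def codeExp (i k : ℕ) : ℕ := 2 ^ (i * (M + 1) + k)

/-- The position of the `k`-th letter `b` in the `i`-th code word. -/
def codePos (i k : ℕ) : ℕ := codeExp M i k + k

open Classical in
/-- The letter at the position `p` in the `i`-th code word. -/
noncomputable def codeLetter (i p : ℕ) : X × Bool :=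
  if ∃ k ≤ M, p = codePos M i k then (b, true)
  else (a, decide (p < codePos M i M))

/-- The word `a^{j₀} b a^{j₁ - j₀} b ⋯ a^{j_M - j_{M-1}} b a^{-j_M}`, where `j_k` is
`codeExp M i k`. -/
noncomputable def codeWord (i : ℕ) : List (X × Bool) :=
  (List.range (codePos M i M + 1 + codeExp M i M)).map (codeLetter a b M i)

lemma codeExp_pos (i k : ℕ) : 0 < codeExp M i k := by
  unfold codeExp
  positivity

/-- Doubling makes the gap after the `k`-th `b` equal to `codeExp M i k` itself, so all gaps, over
all code words, have different lengths. -/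
lemma codeExp_succ (i k : ℕ) : codeExp M i (k + 1) = codeExp M i k + codeExp M i k := by
  rw [codeExp, codeExp, ← add_assoc, pow_succ]
  ring

lemma codePos_succ (i k : ℕ) : codePos M i (k + 1) = codePos M i k + codeExp M i k + 1 := by
  rw [codePos, codePos, codeExp_succ]
  ring

lemma codePos_strictMono (i : ℕ) : StrictMono (codePos M i) :=
  strictMono_nat_of_lt_succ fun k => by
    rw [codePos_succ]
    omega

variable {M}

lemma codeExp_inj {i i' k k' : ℕ} (hk : k ≤ M) (hk' : k' ≤ M)
    (h : codeExp M i k = codeExp M i' k') : i = i' ∧ k = k' := by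
  have h1 := Nat.pow_right_injective le_rfl h
  have h2 : i = i' := by
    have := congrArg (· / (M + 1)) h1
    simp only [mul_comm _ (M + 1)] at this
    rwa [Nat.mul_add_div (by omega), Nat.mul_add_div (by omega), Nat.div_eq_of_lt (by omega),
      Nat.div_eq_of_lt (by omega)] at this
  subst h2
  exact ⟨rfl, by omega⟩

variable {a b}

lemma codeLetter_codePos {i k : ℕ} (hk : k ≤ M) :
    codeLetter a b M i (codePos M i k) = (b, true) :=
  if_pos ⟨k, hk, rfl⟩

lemma codeLetter_of_lt_of_lt {i k p : ℕ} (hk : k < M) (h1 : codePos M i k < p)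
    (h2 : p < codePos M i (k + 1)) : codeLetter a b M i p = (a, true) := by
  rw [codeLetter, if_neg]
  · rw [decide_eq_true]
    exact h2.trans_le ((codePos_strictMono M i).monotone hk)
  · rintro ⟨k', -, rfl⟩
    have h3 := (codePos_strictMono M i).lt_iff_lt.1 h1
    have h4 := (codePos_strictMono M i).lt_iff_lt.1 h2
    omega

lemma codeLetter_of_lt {i p : ℕ} (h : p < codePos M i 0) : codeLetter a b M i p = (a, true) := by
  rw [codeLetter, if_neg]
  · rw [decide_eq_true]
    exact h.trans_le ((codePos_strictMono M i).monotone (Nat.zero_le _))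
  · rintro ⟨k', -, rfl⟩
    have h4 := (codePos_strictMono M i).lt_iff_lt.1 h
    omega

lemma codeLetter_of_gt {i p : ℕ} (h : codePos M i M < p) : codeLetter a b M i p = (a, false) := by
  rw [codeLetter, if_neg]
  · rw [decide_eq_false]
    omega
  · rintro ⟨k', hk', rfl⟩
    have h4 := (codePos_strictMono M i).lt_iff_lt.1 h
    omega

lemma length_codeWord (i : ℕ) :
    (codeWord a b M i).length = codePos M i M + 1 + codeExp M i M := by
  simp [codeWord]

lemma codeWord_getElem? {i p : ℕ} (h : p < codePos M i M + 1 + codeExp M i M) :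
    (codeWord a b M i)[p]? = some (codeLetter a b M i p) := by
  rw [codeWord, List.getElem?_map, List.getElem?_range h]
  rfl

lemma isReduced_codeWord (hab : a ≠ b) (i : ℕ) : FreeGroup.IsReduced (codeWord a b M i) := by
  rw [FreeGroup.IsReduced, List.isChain_iff_getElem]
  intro p h he
  rw [length_codeWord] at h
  have h1 : ∀ q (hq : q < (codeWord a b M i).length),
      (codeWord a b M i)[q] = codeLetter a b M i q := by
    intro q hq
    simp [codeWord]
  rw [h1, h1] at he ⊢
  by_cases hp : ∃ k ≤ M, p = codePos M i k
  · by_cases hp' : ∃ k ≤ M, p + 1 = codePos M i k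
    · rw [codeLetter, codeLetter, if_pos hp, if_pos hp']
    · rw [codeLetter, codeLetter, if_pos hp, if_neg hp'] at he
      exact absurd he.symm hab
  · by_cases hp' : ∃ k ≤ M, p + 1 = codePos M i k
    · rw [codeLetter, codeLetter, if_neg hp, if_pos hp'] at he
      exact absurd he hab
    · rw [codeLetter, codeLetter, if_neg hp, if_neg hp']
      have : p + 1 ≠ codePos M i M := fun h => hp' ⟨M, le_rfl, h⟩
      simp only [decide_eq_decide]
      omega

lemma isMarking_codeWord (hab : a ≠ b) :
    IsMarking (codeWord a b M) M (codePos M) (codeExp M) b where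
  reduced := isReduced_codeWord hab
  pos i k hk := by
    have := (codePos_strictMono M i).lt_iff_lt.2 hk
    rw [codeWord_getElem? (by omega), codeLetter_codePos hk.le]
  no_inv i h := by
    obtain ⟨p, -, hp⟩ := List.mem_map.1 h
    rw [codeLetter] at hp
    split_ifs at hp
    · simp at hp
    · exact hab (congrArg Prod.fst hp)
  lt_length i k hk := by
    have := (codePos_strictMono M i).monotone hk
    rw [length_codeWord, ← codePos_succ]
    simp only [Nat.succ_eq_add_one] at this
    omega
  disjoint i k k' s s' hk hk' hs hs' he := by
    have h1 : ∀ k k', k < k' → codePos M i k + codeExp M i k < codePos M i k' := by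
      intro k k' h
      have := (codePos_strictMono M i).monotone h
      simp only [Nat.succ_eq_add_one, codePos_succ] at this
      omega
    rcases lt_trichotomy k k' with h | h | h
    · have := h1 _ _ h
      omega
    · exact h
    · have := h1 _ _ h
      omega
  -- A match must start at a letter `b`. The last `b` is followed by an inverse of `a`; any other is
  -- followed by a run of `a` whose length determines both indices.
  recog i k hk i' p' hp' hs := by
    rw [length_codeWord] at hp'
    have hmono := (codePos_strictMono M i).monotone hk
    have hs' : ∀ s ≤ codeExp M i k + 1, p' + s < codePos M i' M + 1 + codeExp M i' M →
        codeLetter a b M i' (p' + s) = codeLetter a b M i (codePos M i k + s) := by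
      intro s h1 h2
      have h3 := hs s h1 _ (codeWord_getElem? h2)
      simp only [Nat.succ_eq_add_one, codePos_succ] at hmono
      rw [codeWord_getElem? (by omega)] at h3
      exact (Option.some.inj h3).symm
    have h0 := hs' 0 (by omega) hp'
    rw [add_zero, add_zero, codeLetter_codePos hk.le, codeLetter] at h0
    split_ifs at h0 with hex
    · obtain ⟨k', hk', rfl⟩ := hex
      have hpos := codeExp_pos M i k
      have hpos' := codeExp_pos M i' M
      rcases hk'.eq_or_lt with rfl | hlt
      · have h1 := hs' 1 (by omega) (by omega)
        rw [codeLetter_of_gt (by omega), codeLetter_of_lt_of_lt hk (by omega)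
          (by rw [codePos_succ]; omega)] at h1
        simp at h1
      · have hmono' := (codePos_strictMono M i').monotone hlt
        simp only [Nat.succ_eq_add_one, codePos_succ] at hmono'
        rcases lt_trichotomy (codeExp M i k) (codeExp M i' k') with h | h | h
        · have h1 := hs' (codeExp M i k + 1) le_rfl (by omega)
          rw [← add_assoc, ← add_assoc, ← codePos_succ M i, codeLetter_codePos hk,
            codeLetter_of_lt_of_lt hlt (by omega) (by rw [codePos_succ]; omega)] at h1
          exact absurd (congrArg Prod.fst h1) hab
        · obtain ⟨rfl, rfl⟩ := codeExp_inj hk.le hk' h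
          exact ⟨rfl, rfl⟩
        · have h1 := hs' (codeExp M i' k' + 1) (by omega) (by omega)
          rw [← add_assoc, ← add_assoc, ← codePos_succ M i', codeLetter_codePos hlt,
            codeLetter_of_lt_of_lt hk (by omega) (by rw [codePos_succ]; omega)] at h1
          exact absurd (congrArg Prod.fst h1).symm hab
    · exact absurd (congrArg Prod.fst h0) hab

lemma mk_map_range_add {f : ℕ → X × Bool} {c : X × Bool} (n m : ℕ)
    (h : ∀ p, n ≤ p → p < n + m → f p = c) :
    FreeGroup.mk ((List.range (n + m)).map f) =
      FreeGroup.mk ((List.range n).map f) * FreeGroup.mk [c] ^ m := by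
  induction m with
  | zero => simp
  | succ m ih =>
    rw [← add_assoc, List.range_succ, List.map_append, ← FreeGroup.mul_mk,
      ih fun p h1 h2 => h p h1 (by omega), pow_succ, mul_assoc, List.map_singleton,
      h (n + m) (by omega) (by omega)]

lemma mk_codeWord (i : ℕ) :
    FreeGroup.mk (codeWord a b M i) = ((List.range (M + 1)).map fun k =>
      FreeGroup.of a ^ codeExp M i k * FreeGroup.of b * (FreeGroup.of a ^ codeExp M i k)⁻¹).prod := by
  have h1 : ∀ k ≤ M, FreeGroup.mk ((List.range (codePos M i k + 1)).map (codeLetter a b M i)) =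
      ((List.range (k + 1)).map fun k => FreeGroup.of a ^ codeExp M i k * FreeGroup.of b *
        (FreeGroup.of a ^ codeExp M i k)⁻¹).prod * FreeGroup.of a ^ codeExp M i k := by
    intro k
    induction k with
    | zero =>
      intro _
      rw [mk_map_range_add (codePos M i 0) 1 (c := (b, true)), ← zero_add (codePos M i 0),
        mk_map_range_add 0 (codePos M i 0) (c := (a, true))]
      · change FreeGroup.mk [] * FreeGroup.of a ^ codePos M i 0 * FreeGroup.of b ^ 1 = _
        rw [← FreeGroup.one_eq_mk]
        simp [codePos]
      · intro p _ h
        exact codeLetter_of_lt (by omega)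
      · intro p h2 h3
        obtain rfl : p = codePos M i 0 := by omega
        exact codeLetter_codePos (Nat.zero_le _)
    | succ k ih =>
      intro hk
      rw [mk_map_range_add (codePos M i (k + 1)) 1 (c := (b, true)), codePos_succ,
        add_right_comm, mk_map_range_add (codePos M i k + 1) (codeExp M i k) (c := (a, true)),
        ih (by omega), List.range_succ (n := k + 1), List.map_append, List.prod_append]
      · change _ * FreeGroup.of a ^ codeExp M i k * FreeGroup.of b ^ 1 = _
        simp only [List.map_singleton, List.prod_singleton, codeExp_succ, pow_add]
        group
      · intro p h2 h3
        exact codeLetter_of_lt_of_lt (k := k) (by omega) (by omega) (by rw [codePos_succ]; omega)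
      · intro p h2 h3
        obtain rfl : p = codePos M i (k + 1) := by omega
        exact codeLetter_codePos hk
  rw [codeWord, mk_map_range_add _ _ (c := (a, false)), h1 M le_rfl]
  · have : FreeGroup.mk [(a, false)] = (FreeGroup.of a)⁻¹ := mk_letterInv (a, true)
    rw [this]
    group
  · intro p h2 _
    exact codeLetter_of_gt (by omega)

end Code

/-! ### Root-closed embeddings -/

section RootClosed

/-- An injective homomorphism whose image is closed under taking roots. -/
structure IsRootClosedHom {G H : Type*} [Group G] [Group H] (f : G →* H) : Prop where
  injective : Function.Injective f
  isPrimitive : IsPrimitiveSubgroup f.range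

variable {G H K : Type*} [Group G] [Group H] [Group K]

lemma IsRootClosedHom.map {f : G →* H} (hf : IsRootClosedHom f) {S : Subgroup G}
    (hS : IsPrimitiveSubgroup S) : IsPrimitiveSubgroup (S.map f) := by
  rintro t n hn ⟨s, hs, hst⟩
  obtain ⟨u, rfl⟩ := hf.isPrimitive t n hn ⟨s, hst⟩
  rw [← map_pow] at hst
  exact ⟨u, hS u n hn (hf.injective hst ▸ hs), rfl⟩

lemma IsRootClosedHom.comp {f : H →* K} {f' : G →* H} (hf : IsRootClosedHom f)
    (hf' : IsRootClosedHom f') : IsRootClosedHom (f.comp f') :=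
  ⟨hf.injective.comp hf'.injective, by
    rw [MonoidHom.range_comp]
    exact hf.map hf'.isPrimitive⟩

/-- If `t ^ n` lies in the image of a section, `t` and its retraction have the same `n`-th power,
and roots are unique. -/
lemma IsRootClosedHom.of_leftInverse [IsMulTorsionFree H] {f : G →* H} (r : H →* G)
    (h : ∀ x, r (f x) = x) : IsRootClosedHom f := by
  refine ⟨Function.LeftInverse.injective h, ?_⟩
  rintro t n hn ⟨s, hs⟩
  refine ⟨r t, IsMulTorsionFree.pow_left_injective hn.ne' ?_⟩
  simp only
  rw [← map_pow, ← map_pow, ← hs, h, hs]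

lemma IsRootClosedHom.mulEquiv [IsMulTorsionFree H] (e : G ≃* H) :
    IsRootClosedHom e.toMonoidHom :=
  .of_leftInverse e.symm.toMonoidHom fun x => e.symm_apply_apply x

/-- The action of `ℤ` on the free group on `ℤ` by translation of the generators. -/
def shiftAut : Multiplicative ℤ →* MulAut (FreeGroup ℤ) :=
  MonoidHom.mk' (fun k => FreeGroup.freeGroupCongr (Equiv.addLeft k.toAdd)) fun k l => by
    refine MulEquiv.toMonoidHom_injective (FreeGroup.ext_hom _ _ fun j => ?_)
    simp [add_assoc]

/-- The homomorphism that maps the `j`-th generator to `u ^ j * v * u ^ (-j)`. -/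
def conjHom (u v : G) : FreeGroup ℤ →* G :=
  FreeGroup.lift fun j => u ^ j * v * (u ^ j)⁻¹

/-- If `G` maps to the semidirect product of the free group on `ℤ` and `ℤ` such that `u` is mapped
to the translation and `v` to a generator, then the conjugates of `v` under powers of `u` generate
freely a root-closed subgroup. -/
lemma isRootClosedHom_conjHom [IsMulTorsionFree G] {u v : G}
    (F : G →* FreeGroup ℤ ⋊[shiftAut] Multiplicative ℤ)
    (hu : F u = SemidirectProduct.inr (Multiplicative.ofAdd 1))
    (hv : F v = SemidirectProduct.inl (FreeGroup.of 0)) : IsRootClosedHom (conjHom u v) := by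
  have hF : ∀ x, F (conjHom u v x) = SemidirectProduct.inl x := by
    intro x
    suffices F.comp (conjHom u v) = SemidirectProduct.inl from DFunLike.congr_fun this x
    ext1 j
    have h1 : FreeGroup.of j = shiftAut (Multiplicative.ofAdd j) (FreeGroup.of 0) := by
      simp [shiftAut]
    rw [h1, SemidirectProduct.inl_aut, MonoidHom.comp_apply, ← h1, conjHom,
      FreeGroup.lift_apply_of, map_mul, map_mul, map_inv, map_zpow, hu, hv, ← map_zpow, ← map_inv,
      ← ofAdd_zsmul]
    simp
  refine ⟨fun x y h => SemidirectProduct.inl_injective (by rw [← hF, ← hF, h]), ?_⟩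
  rintro t n hn ⟨s, hs⟩
  have h1 : F t ^ n = SemidirectProduct.inl s := by rw [← map_pow, ← hs, hF]
  -- `ℤ` has no torsion, so `F t` lies in the normal free factor. Its lift by `conjHom` has the same
  -- `n`-th power as `t`, hence equals `t`; injectivity of `F` is not needed.
  have h2 : (F t).right = 1 := by
    have h3 := congrArg SemidirectProduct.rightHom h1
    rw [map_pow, SemidirectProduct.rightHom_inl] at h3
    exact IsMulTorsionFree.pow_left_injective hn.ne' (h3.trans (one_pow n).symm)
  have h3 : F t = SemidirectProduct.inl (F t).left := by
    ext <;> simp [h2]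
  rw [h3, ← map_pow] at h1
  refine ⟨(F t).left, IsMulTorsionFree.pow_left_injective hn.ne' ?_⟩
  simp only
  rw [← map_pow, SemidirectProduct.inl_injective h1, hs]

end RootClosed

/-! ### The code homomorphism -/

section CodeHom

variable {X : Type*} {a b : X} {M : ℕ}

/-- The homomorphism that maps the `i`-th generator to the product of the generators
`codeExp M i k` for `k ≤ M`. -/
def blockHom (M : ℕ) : FreeGroup ℕ →* FreeGroup ℤ :=
  FreeGroup.lift fun i => ((List.range (M + 1)).map fun k => FreeGroup.of (codeExp M i k : ℤ)).prod

/-- The blocks use disjoint sets of generators, so keeping the first generator of each block and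
killing all others is a retraction. -/
lemma isRootClosedHom_blockHom (M : ℕ) : IsRootClosedHom (blockHom M) := by
  classical
  let r : FreeGroup ℤ →* FreeGroup ℕ := FreeGroup.lift fun j =>
    if h : ∃ i, j = (codeExp M i 0 : ℤ) then FreeGroup.of h.choose else 1
  refine .of_leftInverse r fun x => ?_
  suffices r.comp (blockHom M) = MonoidHom.id _ from DFunLike.congr_fun this x
  ext1 i
  have h0 : r (FreeGroup.of (codeExp M i 0 : ℤ)) = FreeGroup.of i := by
    have h : ∃ i', (codeExp M i 0 : ℤ) = (codeExp M i' 0 : ℤ) := ⟨i, rfl⟩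
    simp only [r, FreeGroup.lift_apply_of]
    rw [dif_pos h]
    have h1 := h.choose_spec
    rw [Nat.cast_inj] at h1
    rw [← (codeExp_inj (Nat.zero_le _) (Nat.zero_le _) h1).1]
  have h1 : ∀ k < M, r (FreeGroup.of (codeExp M i (k + 1) : ℤ)) = 1 := by
    intro k hk
    simp only [r, FreeGroup.lift_apply_of]
    rw [dif_neg]
    rintro ⟨i', h⟩
    rw [Nat.cast_inj] at h
    have := (codeExp_inj (by omega) (by omega) h).2
    omega
  rw [MonoidHom.comp_apply, blockHom, FreeGroup.lift_apply_of, map_list_prod, List.map_map,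
    List.range_succ_eq_map, List.map_cons, List.prod_cons, List.map_map, List.prod_eq_one, mul_one]
  · exact h0
  · intro x hx
    obtain ⟨k, hk, rfl⟩ := List.mem_map.1 hx
    exact h1 k (List.mem_range.1 hk)

variable (a b M) in
/-- The homomorphism that maps the `i`-th generator to the `i`-th code word. -/
noncomputable def codeHom : FreeGroup ℕ →* FreeGroup X :=
  FreeGroup.lift fun i => FreeGroup.mk (codeWord a b M i)

lemma isRootClosedHom_codeHom (hab : a ≠ b) : IsRootClosedHom (codeHom a b M) := by
  classical
  have h : codeHom a b M = (conjHom (FreeGroup.of a) (FreeGroup.of b)).comp (blockHom M) := by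
    ext1 i
    rw [codeHom, FreeGroup.lift_apply_of, mk_codeWord, MonoidHom.comp_apply, blockHom,
      FreeGroup.lift_apply_of, map_list_prod, List.map_map]
    congr 1
    refine List.map_congr_left fun k _ => ?_
    simp [conjHom]
  rw [h]
  refine IsRootClosedHom.comp ?_ (isRootClosedHom_blockHom M)
  refine isRootClosedHom_conjHom (FreeGroup.lift fun x =>
    if x = a then SemidirectProduct.inr (Multiplicative.ofAdd 1) else
    SemidirectProduct.inl (FreeGroup.of 0)) ?_ ?_
  · simp
  · simp [hab.symm]

lemma HasRepresentation.of_codeHom (hab : a ≠ b) {g : ℕ} {x : FreeGroup ℕ}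
    (hM : 12 * g + 3 * x.toWord.length < M) (h : HasRepresentation g (codeHom a b M x)) :
    HasRepresentation g x := by
  rw [← FreeGroup.mk_toWord (x := x), codeHom, ← mk_substWord, ← hasPairing_iff] at h
  have := HasPairing.of_substWord (isMarking_codeWord hab) hM h
  rwa [hasPairing_iff, FreeGroup.mk_toWord] at this

end CodeHom


/-! ### Free products of root-closed embeddings -/

section FreeProduct

open Monoid.CoprodI

variable {ι : Type*} {G H : ι → Type*} [∀ i, Group (G i)] [∀ i, Group (H i)]

lemma neWord_prod_ne_one {i j : ι} (w : NeWord G i j) : w.prod ≠ 1 := by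
  classical
  intro h
  have h1 : w.toWord = Word.empty := Word.equiv.symm.injective (h.trans Word.prod_empty.symm)
  exact w.toList_ne_nil (congrArg Word.toList h1)

lemma neWord_toList_eq {i j i' j' : ι} {w : NeWord G i j} {w' : NeWord G i' j'}
    (h : w.prod = w'.prod) : w.toList = w'.toList := by
  classical
  exact congrArg Word.toList (Word.equiv.symm.injective h : w.toWord = w'.toWord)

lemma exists_neWord {x : Monoid.CoprodI G} (hx : x ≠ 1) :
    ∃ (i j : ι) (w : NeWord G i j), w.prod = x := by
  classical
  obtain ⟨i, j, w, hw⟩ := NeWord.of_word (Word.equiv x) (by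
    intro h
    apply hx
    rw [← Word.equiv.symm_apply_apply x, h]
    exact Word.prod_empty)
  refine ⟨i, j, w, ?_⟩
  rw [NeWord.prod, hw]
  exact Word.equiv.symm_apply_apply x

/-- All syllables of `w` lie in the given subgroups. -/
def SyllablesIn (R : ∀ i, Subgroup (G i)) {i j : ι} (w : NeWord G i j) : Prop :=
  ∀ s ∈ w.toList, s.2 ∈ R s.1

variable {R : ∀ i, Subgroup (G i)}

lemma syllablesIn_singleton {i : ι} {x : G i} {hx : x ≠ 1} :
    SyllablesIn R (.singleton x hx) ↔ x ∈ R i := by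
  simp [SyllablesIn, NeWord.toList]

lemma syllablesIn_append {i j k l : ι} {w₁ : NeWord G i j} {hne : j ≠ k} {w₂ : NeWord G k l} :
    SyllablesIn R (.append w₁ hne w₂) ↔ SyllablesIn R w₁ ∧ SyllablesIn R w₂ := by
  simp only [SyllablesIn, NeWord.toList, List.mem_append, or_imp, forall_and]

lemma neWord_prod_eq_of_toList_eq {i j i' j' : ι} {w : NeWord G i j} {w' : NeWord G i' j'}
    (h : w.toList = w'.toList) : w.prod = w'.prod := by
  rw [NeWord.prod, NeWord.prod, Word.prod, Word.prod]
  exact congrArg (fun l => (l.map fun s : Σ i, G i => of s.2).prod) h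

lemma syllablesIn_of_toList_eq {i j i' j' : ι} {w : NeWord G i j} {w' : NeWord G i' j'}
    (h : w.toList = w'.toList) (hw : SyllablesIn R w) : SyllablesIn R w' :=
  fun s hs => hw s (h ▸ hs)

/-- Stated for `toList`, since a `NeWord` also records a bracketing of its syllables. -/
lemma neWord_cases_left {i j : ι} (w : NeWord G i j) :
    (i = j ∧ ∃ (x : G i) (hx : x ≠ 1), w.toList = (NeWord.singleton x hx).toList) ∨
      ∃ (x : G i) (hx : x ≠ 1) (k : ι) (hne : i ≠ k) (w' : NeWord G k j),
        w.toList = (NeWord.append (.singleton x hx) hne w').toList := by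
  induction w with
  | singleton x hx => exact .inl ⟨rfl, x, hx, rfl⟩
  | append w₁ hne w₂ ih₁ _ =>
    right
    rcases ih₁ with ⟨rfl, x, hx, h⟩ | ⟨x, hx, k, hne', w', h⟩
    · exact ⟨x, hx, _, hne, w₂, by simp [NeWord.toList, h]⟩
    · exact ⟨x, hx, k, hne', .append w' hne w₂, by simp [NeWord.toList, h]⟩

lemma neWord_cases_right {i j : ι} (w : NeWord G i j) :
    (i = j ∧ ∃ (x : G j) (hx : x ≠ 1), w.toList = (NeWord.singleton x hx).toList) ∨
      ∃ (x : G j) (hx : x ≠ 1) (k : ι) (hne : k ≠ j) (w' : NeWord G i k),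
        w.toList = (NeWord.append w' hne (.singleton x hx)).toList := by
  induction w with
  | singleton x hx => exact .inl ⟨rfl, x, hx, rfl⟩
  | append w₁ hne w₂ _ ih₂ =>
    right
    rcases ih₂ with ⟨rfl, x, hx, h⟩ | ⟨x, hx, k, hne', w', h⟩
    · exact ⟨x, hx, _, hne, w₁, by simp [NeWord.toList, h]⟩
    · exact ⟨x, hx, k, hne', .append w₁ hne w', by simp [NeWord.toList, h]⟩

/-- The power is `x m (yx) m ⋯ (yx) m y`, already reduced because `yx ≠ 1`. The final `y` is left
off to make the induction run. -/
lemma exists_neWord_conj_pow {i k l : ι} {x y : G i} (hx : x ≠ 1) (hik : i ≠ k)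
    (hli : l ≠ i) (m : NeWord G k l) (hyx : y * x ≠ 1) (n : ℕ) :
    ∃ v : NeWord G i l, v.prod * of y = (of x * m.prod * of y) ^ (n + 1) ∧
      (SyllablesIn R v → x ∈ R i ∧ SyllablesIn R m) := by
  induction n with
  | zero =>
    exact ⟨.append (.singleton x hx) hik m, by simp, fun h => by
      rwa [syllablesIn_append, syllablesIn_singleton] at h⟩
  | succ n ih =>
    obtain ⟨v, hv, hR⟩ := ih
    refine ⟨.append v hli (.append (.singleton _ hyx) hik m), ?_, fun h =>
      hR (syllablesIn_append.1 h).1⟩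
    rw [pow_succ, ← hv]
    simp [mul_assoc]

/-- The normal form of a power of a reduced word of a free product has syllables in given
root-closed subgroups only if the word itself has. -/
lemma exists_neWord_pow [∀ i, IsMulTorsionFree (G i)] (hR : ∀ i, IsPrimitiveSubgroup (R i))
    {n : ℕ} (hn : 0 < n) (N : ℕ) : ∀ {i j : ι} (w : NeWord G i j), w.toList.length ≤ N →
    ∃ w' : NeWord G i j, w'.prod = w.prod ^ n ∧ (SyllablesIn R w' → SyllablesIn R w) := by
  induction N with
  | zero =>
    intro i j w hw
    exact absurd (List.length_eq_zero_iff.1 (Nat.le_zero.1 hw)) w.toList_ne_nil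
  | succ N ih =>
    intro i j w hw
    obtain ⟨n, rfl⟩ := Nat.exists_eq_succ_of_ne_zero hn.ne'
    by_cases hij : i = j
    · subst hij
      rcases neWord_cases_left w with ⟨-, x, hx, h⟩ | ⟨x, hx, k, hik, w₁, h⟩
      · have hx' : x ^ (n + 1) ≠ 1 := fun h =>
          hx (IsMulTorsionFree.pow_left_injective hn.ne' (h.trans (one_pow _).symm))
        refine ⟨.singleton _ hx', ?_, fun hs => syllablesIn_of_toList_eq h.symm ?_⟩
        · rw [neWord_prod_eq_of_toList_eq h]
          simp
        · rw [syllablesIn_singleton] at hs ⊢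
          exact hR i x _ hn hs
      · rcases neWord_cases_right w₁ with ⟨hk, -⟩ | ⟨y, hy, l, hli, m, h₁⟩
        · exact absurd hk.symm hik
        · have hl : w.toList = (NeWord.append (.singleton x hx) hik
              (.append m hli (.singleton y hy))).toList := by
            rw [h, NeWord.toList, h₁]
            rfl
          have hp : w.prod = of x * m.prod * of y := by
            rw [neWord_prod_eq_of_toList_eq hl]
            simp [mul_assoc]
          -- If the end syllables cancel, `w` is a conjugate of the shorter word `m`; otherwise `w`
          -- is cyclically reduced after merging them.
          by_cases hyx : y * x = 1
          · obtain ⟨m', hm', hmR⟩ := ih m (by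
              have := congrArg List.length hl
              simp only [NeWord.toList, List.length_append, List.length_singleton] at this
              omega)
            refine ⟨.append (.singleton x hx) hik (.append m' hli (.singleton y hy)), ?_,
              fun hs => syllablesIn_of_toList_eq hl.symm ?_⟩
            · obtain rfl := eq_inv_of_mul_eq_one_left hyx
              rw [hp]
              rw [map_inv, conj_pow]
              simp [hm', mul_assoc]
            · simp only [syllablesIn_append] at hs ⊢
              exact ⟨hs.1, hmR hs.2.1, hs.2.2⟩
          · obtain ⟨v, hv, hvR⟩ := exists_neWord_conj_pow (R := R) hx hik hli m hyx n
            refine ⟨.append v hli (.singleton y hy), ?_,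
              fun hs => syllablesIn_of_toList_eq hl.symm ?_⟩
            · rw [hp, ← hv]
              simp
            · simp only [syllablesIn_append, syllablesIn_singleton] at hs ⊢
              exact ⟨(hvR hs.1).1, (hvR hs.1).2, hs.2⟩
    · clear ih hw
      induction n with
      | zero => exact ⟨w, by simp, id⟩
      | succ n ihn =>
        obtain ⟨w', hw', hs⟩ := ihn n.succ_pos
        refine ⟨.append w' (Ne.symm hij) w, ?_, fun h => (syllablesIn_append.1 h).2⟩
        rw [NeWord.append_prod, hw', ← pow_succ]

variable {f : ∀ i, H i →* G i}

/-- The homomorphism of free products induced by homomorphisms of the factors. -/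
def coprodMap (f : ∀ i, H i →* G i) : Monoid.CoprodI H →* Monoid.CoprodI G :=
  Monoid.CoprodI.lift fun i => of.comp (f i)

lemma exists_neWord_coprodMap (hf : ∀ i, Function.Injective (f i)) {i j : ι} (w : NeWord H i j) :
    ∃ w' : NeWord G i j, w'.prod = coprodMap f w.prod ∧
      SyllablesIn (fun i => (f i).range) w' := by
  induction w with
  | singleton x hx =>
    refine ⟨.singleton (f _ x) ((map_ne_one_iff _ (hf _)).2 hx), ?_, ?_⟩
    · simp [coprodMap]
    · exact syllablesIn_singleton.2 ⟨x, rfl⟩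
  | append w₁ hne w₂ ih₁ ih₂ =>
    obtain ⟨v₁, h₁, hs₁⟩ := ih₁
    obtain ⟨v₂, h₂, hs₂⟩ := ih₂
    exact ⟨.append v₁ hne v₂, by simp [h₁, h₂], syllablesIn_append.2 ⟨hs₁, hs₂⟩⟩

lemma prod_mem_range_coprodMap {i j : ι} {w : NeWord G i j}
    (hw : SyllablesIn (fun i => (f i).range) w) : w.prod ∈ (coprodMap f).range := by
  induction w with
  | singleton x hx =>
    obtain ⟨y, rfl⟩ := syllablesIn_singleton.1 hw
    exact ⟨of y, by simp [coprodMap]⟩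
  | append w₁ hne w₂ ih₁ ih₂ =>
    rw [NeWord.append_prod]
    exact mul_mem (ih₁ (syllablesIn_append.1 hw).1) (ih₂ (syllablesIn_append.1 hw).2)

/-- Factorwise injectivity sends reduced words to reduced words, so the image consists of the
elements all of whose syllables lie in the factor images. `exists_neWord_pow` passes this condition
from a power to its root. -/
lemma isRootClosedHom_coprodMap [∀ i, IsMulTorsionFree (G i)] (hf : ∀ i, IsRootClosedHom (f i)) :
    IsRootClosedHom (coprodMap f) := by
  refine ⟨(injective_iff_map_eq_one _).2 fun x hx => ?_, ?_⟩
  · by_contra hx1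
    obtain ⟨i, j, w, rfl⟩ := exists_neWord hx1
    obtain ⟨w', hw', -⟩ := exists_neWord_coprodMap (fun i => (hf i).injective) w
    exact neWord_prod_ne_one w' (hw'.trans hx)
  · rintro t n hn ⟨s, hs⟩
    by_cases ht : t = 1
    · exact ht ▸ one_mem _
    obtain ⟨i, j, w, rfl⟩ := exists_neWord ht
    obtain ⟨w', hw', hw⟩ := exists_neWord_pow (fun i => (hf i).isPrimitive) hn _ w le_rfl
    have hs1 : s ≠ 1 := by
      rintro rfl
      exact neWord_prod_ne_one w' (by rw [hw', ← hs, map_one])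
    obtain ⟨k, l, v, rfl⟩ := exists_neWord hs1
    obtain ⟨v', hv', hv⟩ := exists_neWord_coprodMap (fun i => (hf i).injective) v
    exact prod_mem_range_coprodMap
      (hw (syllablesIn_of_toList_eq (neWord_toList_eq (hv'.trans (hs.trans hw'.symm))) hv))

end FreeProduct

/-! ### Joining two representations -/

section Glue

variable {ι : Type*} {X Y : ι → Type*}

/-- The free group on a disjoint union is the free product of the free groups. -/
def sigmaEquiv (X : ι → Type*) :
    FreeGroup (Σ i, X i) ≃* Monoid.CoprodI fun i => FreeGroup (X i) :=
  MonoidHom.toMulEquiv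
    (FreeGroup.lift fun s => Monoid.CoprodI.of (FreeGroup.of s.2))
    (Monoid.CoprodI.lift fun i => FreeGroup.map (Sigma.mk i))
    (by ext; simp) (by ext; simp)

lemma isMulTorsionFree_of_mulEquiv {G H : Type*} [Group G] [Group H] [IsMulTorsionFree H]
    (e : G ≃* H) : IsMulTorsionFree G :=
  ⟨fun n hn x y h => e.injective (IsMulTorsionFree.pow_left_injective hn (by
    simp only at h ⊢
    rw [← map_pow, ← map_pow, h]))⟩

variable {X : Type*} {m n : ℕ}

lemma comp_glue {G G' : Type*} [Group G] [Group G'] (k : G →* G') (f : SurfaceGroup m →* G)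
    (f' : SurfaceGroup n →* G) : k.comp (glue f f') = glue (k.comp f) (k.comp f') := by
  ext ⟨i, c⟩
  induction i using Fin.addCases <;> simp [glue]

lemma glue_inclLeft_inclRight : glue (inclLeft m n) (inclRight m n) = MonoidHom.id _ := by
  ext ⟨i, c⟩
  induction i using Fin.addCases <;> simp [glue, inclLeft, inclRight]

/-- The joined map is the free product of `h₁` and `h₂`, between identifications of free groups with
free products; these have left inverses. -/
lemma isRootClosedHom_glue {h₁ : SurfaceGroup m →* FreeGroup X}
    {h₂ : SurfaceGroup n →* FreeGroup X} (hh₁ : IsRootClosedHom h₁) (hh₂ : IsRootClosedHom h₂) :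
    IsRootClosedHom (glue ((FreeGroup.map (Prod.mk false)).comp h₁)
      ((FreeGroup.map (Prod.mk true)).comp h₂)) := by
  let Y : Bool → Type := fun β => Fin (bif β then n else m) × Bool
  let f : ∀ β, FreeGroup (Y β) →* FreeGroup X := fun β => match β with
    | false => h₁
    | true => h₂
  have hf : ∀ β, IsRootClosedHom (f β) := by
    intro β
    cases β
    · exact hh₁
    · exact hh₂
  let j : SurfaceGroup (m + n) →* Monoid.CoprodI fun β => FreeGroup (Y β) :=
    glue (Monoid.CoprodI.of (M := fun β => FreeGroup (Y β)) (i := false))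
      (Monoid.CoprodI.of (M := fun β => FreeGroup (Y β)) (i := true))
  let r : (Monoid.CoprodI fun β => FreeGroup (Y β)) →* SurfaceGroup (m + n) :=
    Monoid.CoprodI.lift fun β => match β with
      | false => inclLeft m n
      | true => inclRight m n
  let p : (Monoid.CoprodI fun _ : Bool => FreeGroup X) →* FreeGroup (Bool × X) :=
    Monoid.CoprodI.lift fun β => FreeGroup.map (Prod.mk β)
  let q : FreeGroup (Bool × X) →* Monoid.CoprodI fun _ : Bool => FreeGroup X :=
    FreeGroup.lift fun s => Monoid.CoprodI.of (i := s.1) (FreeGroup.of s.2)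
  have : IsMulTorsionFree (Monoid.CoprodI fun β => FreeGroup (Y β)) :=
    isMulTorsionFree_of_mulEquiv (sigmaEquiv Y).symm
  have hj : IsRootClosedHom j := .of_leftInverse r fun x => by
    suffices r.comp j = MonoidHom.id _ from DFunLike.congr_fun this x
    simp only [j, r, comp_glue, Monoid.CoprodI.lift_comp_of]
    exact glue_inclLeft_inclRight
  have hp : IsRootClosedHom p := .of_leftInverse q fun x => by
    suffices q.comp p = MonoidHom.id _ from DFunLike.congr_fun this x
    ext
    simp [p, q]
  have := (hp.comp (isRootClosedHom_coprodMap hf)).comp hj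
  convert this using 1
  simp only [j, comp_glue, p, MonoidHom.comp_assoc, coprodMap, Monoid.CoprodI.lift_comp_of, f]
  simp only [← MonoidHom.comp_assoc, Monoid.CoprodI.lift_comp_of]

end Glue


/-! ### An element of genus one with two images -/

section GenusOne

/-- The homomorphism from the genus one surface group with prescribed values at the generators. -/
def surfaceHom {G : Type*} [Group G] (u v : G) : SurfaceGroup 1 →* G :=
  FreeGroup.lift fun p => if p.2 then v else u

lemma surfaceHom_boundary {G : Type*} [Group G] (u v : G) :
    surfaceHom u v (boundary 1) = u * v * u⁻¹ * v⁻¹ := by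
  simp [boundary_one, surfaceHom]

lemma comp_surfaceHom {G H : Type*} [Group G] [Group H] (f : G →* H) (u v : G) :
    f.comp (surfaceHom u v) = surfaceHom (f u) (f v) := by
  ext ⟨i, c⟩
  cases c <;> simp [surfaceHom]

lemma isRootClosedHom_surfaceHom {s : ℤ} (hs : s * s = 1) :
    IsRootClosedHom (surfaceHom (FreeGroup.of (0 : ℤ) ^ s)
      (FreeGroup.of 0 ^ (-s) * (FreeGroup.of (-1))⁻¹ * FreeGroup.of 0 ^ (-s) *
        (FreeGroup.of 1)⁻¹)) := by
  -- Generator `-1` is killed, generator `0` recovers the first handle generator, and the value at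
  -- `1` is solved from the second. `s = ± 1` serves both pairs below.
  let r : FreeGroup ℤ →* SurfaceGroup 1 := FreeGroup.lift fun j =>
    if j = 0 then FreeGroup.of (0, false) ^ s else
    if j = 1 then (FreeGroup.of (0, true))⁻¹ * FreeGroup.of (0, false) ^ (-2 : ℤ) else 1
  refine .of_leftInverse r fun x => ?_
  rw [← MonoidHom.comp_apply, comp_surfaceHom]
  suffices surfaceHom (FreeGroup.of (0, false)) (FreeGroup.of (0, true)) =
      MonoidHom.id (SurfaceGroup 1) by
    have h0 : r (FreeGroup.of 0) = FreeGroup.of (0, false) ^ s := by simp [r]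
    have h1 : r (FreeGroup.of 1) =
      (FreeGroup.of (0, true))⁻¹ * FreeGroup.of (0, false) ^ (-2 : ℤ) := by simp [r]
    have h2 : r (FreeGroup.of (-1)) = 1 := by simp [r]
    simp only [map_mul, map_inv, map_zpow, h0, h1, h2, ← zpow_mul, mul_neg, hs, zpow_one]
    refine Eq.trans ?_ (DFunLike.congr_fun this x)
    congr 2
    group
  ext ⟨i, c⟩
  rw [Subsingleton.elim i 0]
  cases c <;> simp [surfaceHom]

variable {X : Type*} {a b : X}

lemma isRootClosedHom_surfaceHom_of (hab : a ≠ b) :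
    IsRootClosedHom (surfaceHom (FreeGroup.of a)
      ((FreeGroup.of a)⁻¹ * (FreeGroup.of b)⁻¹ * (FreeGroup.of a)⁻¹ * FreeGroup.of b *
        (FreeGroup.of a)⁻¹ * FreeGroup.of b * (FreeGroup.of a)⁻¹ * (FreeGroup.of b)⁻¹)) := by
  classical
  have h1 : IsRootClosedHom (conjHom (FreeGroup.of b) (FreeGroup.of a)) :=
    isRootClosedHom_conjHom (FreeGroup.lift fun x =>
      if x = b then SemidirectProduct.inr (Multiplicative.ofAdd 1) else
      SemidirectProduct.inl (FreeGroup.of 0)) (by simp) (by simp [hab])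
  have h2 := h1.comp (isRootClosedHom_surfaceHom (s := 1) rfl)
  rw [comp_surfaceHom] at h2
  convert h2 using 2
  · simp [conjHom]
  · simp only [conjHom, map_mul, map_inv, map_zpow, FreeGroup.lift_apply_of]
    group

/-- Same pattern with `a` and `b` in other roles: conjugates of `a⁻¹ b a⁻¹` by powers of `a`, and `s
= -1`. -/
lemma isRootClosedHom_surfaceHom_of' (hab : a ≠ b) :
    IsRootClosedHom (surfaceHom (FreeGroup.of a * (FreeGroup.of b)⁻¹ * FreeGroup.of a)
      ((FreeGroup.of a)⁻¹ * FreeGroup.of b * (FreeGroup.of a)⁻¹ * (FreeGroup.of b)⁻¹ *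
        FreeGroup.of a * FreeGroup.of b * FreeGroup.of a * (FreeGroup.of b)⁻¹)) := by
  classical
  have h1 : IsRootClosedHom (conjHom (FreeGroup.of a)
      ((FreeGroup.of a)⁻¹ * FreeGroup.of b * (FreeGroup.of a)⁻¹)) :=
    isRootClosedHom_conjHom (FreeGroup.lift fun x =>
      if x = a then SemidirectProduct.inr (Multiplicative.ofAdd 1) else
      SemidirectProduct.inr (Multiplicative.ofAdd 1) * SemidirectProduct.inl (FreeGroup.of 0) *
        SemidirectProduct.inr (Multiplicative.ofAdd 1)) (by simp)
      (by simp only [map_mul, map_inv, FreeGroup.lift_apply_of, if_true, hab.symm, if_false]; group)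
  have h2 := h1.comp (isRootClosedHom_surfaceHom (s := -1) rfl)
  rw [comp_surfaceHom] at h2
  convert h2 using 2
  · simp only [conjHom, map_zpow, FreeGroup.lift_apply_of]
    group
  · simp only [conjHom, map_mul, map_inv, map_zpow, FreeGroup.lift_apply_of]
    group

lemma mem_commutator_of_hasRepresentation {G : Type*} [Group G] {g : ℕ} {x : G}
    (h : HasRepresentation g x) : x ∈ commutator G := by
  obtain ⟨f, rfl⟩ := h
  rw [← Abelianization.ker_of G, MonoidHom.mem_ker, ← MonoidHom.comp_apply]
  exact map_boundary_eq_one _ fun i => Commute.all _ _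

lemma minimalCount_le_fHat' {G : Type*} [Group G] {x : G} (hx : x ∈ commutator G) :
    minimalCount x ≤ fHat' G (algebraicGenus x) :=
  le_iSup₂_of_le x ⟨hx, rfl⟩ le_rfl

lemma HasRepresentation.algebraicGenus {G : Type*} [Group G] {g : ℕ} {x : G}
    (h : HasRepresentation g x) : HasRepresentation (algebraicGenus x) x :=
  Nat.sInf_mem (s := {g : ℕ | ∃ h : SurfaceGroup g →* G, IsRepresentation x h}) ⟨g, h⟩

lemma two_le_fHat'_one (hab : a ≠ b) : 2 ≤ fHat' (FreeGroup X) 1 := by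
  classical
  set α := FreeGroup.of a
  set β := FreeGroup.of b
  let h₂ := surfaceHom α (α⁻¹ * β⁻¹ * α⁻¹ * β * α⁻¹ * β * α⁻¹ * β⁻¹)
  let h₁ := (MulAut.conj (α⁻¹ * β⁻¹ * α⁻¹ * β)).toMonoidHom.comp (surfaceHom (α * β⁻¹ * α)
    (α⁻¹ * β * α⁻¹ * β⁻¹ * α * β * α * β⁻¹))
  have hh₂ : IsRootClosedHom h₂ := isRootClosedHom_surfaceHom_of hab
  have hh₁ : IsRootClosedHom h₁ :=
    (IsRootClosedHom.mulEquiv _).comp (isRootClosedHom_surfaceHom_of' hab)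
  have hx : h₁ (boundary 1) = h₂ (boundary 1) := by
    simp only [h₁, h₂, MonoidHom.comp_apply, surfaceHom_boundary, MulEquiv.toMonoidHom_eq_coe,
      MonoidHom.coe_coe, MulAut.conj_apply]
    group
  have hr : HasRepresentation 1 (h₂ (boundary 1)) := ⟨h₂, rfl⟩
  have hg : algebraicGenus (h₂ (boundary 1)) = 1 := by
    refine (algebraicGenus_le hr).antisymm ?_
    have hmem := hr.algebraicGenus
    by_contra h0
    rw [Nat.not_le, Nat.lt_one_iff] at h0
    rw [h0] at hmem
    obtain ⟨h, hh⟩ := hmem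
    have hb : boundary 1 = 1 := hh₂.injective (by rw [← hh, map_one]; simp [boundary])
    exact Nat.not_succ_le_zero 0 (le_of_hasRepresentation_boundary ⟨1, by
      rw [hb, IsRepresentation, MonoidHom.one_apply]⟩)
  have h := minimalCount_le_fHat' (mem_commutator_of_hasRepresentation hr)
  rw [hg] at h
  refine le_trans ?_ h
  have hne : h₁.range ≠ h₂.range := by
    intro h
    have hα : α ∈ h₁.range := h ▸ ⟨FreeGroup.of (0, false), by simp [h₂, surfaceHom]⟩
    obtain ⟨y, hy⟩ := hα
    -- With weights 1 for `a` and 2 for `b`, both generators of the first image have weight zero,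
    -- while `α` lies in the second image and has weight 1.
    let φ : FreeGroup X →* Multiplicative ℤ :=
      FreeGroup.lift fun x => if x = a then Multiplicative.ofAdd 1 else Multiplicative.ofAdd 2
    have hφ : φ.comp h₁ = 1 := by
      ext ⟨i, c⟩
      cases c <;> simp [h₁, surfaceHom, φ, α, β, hab.symm]
    have := DFunLike.congr_fun hφ y
    rw [MonoidHom.comp_apply, hy] at this
    simp [φ, α] at this
  rw [minimalCount, ← Set.encard_pair hne]
  refine Set.encard_le_encard (Set.insert_subset ?_ (Set.singleton_subset_iff.2 ?_))
  · exact ⟨1, h₁, hg.symm, ⟨hx, hh₁.injective, hh₁.isPrimitive⟩, rfl⟩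
  · exact ⟨1, h₂, hg.symm, ⟨rfl, hh₂.injective, hh₂.isPrimitive⟩, rfl⟩

end GenusOne


/-! ### Invariance under isomorphism -/

section Invariance

variable {G H : Type*} [Group G] [Group H]

lemma algebraicGenus_mulEquiv (e : G ≃* H) (x : G) : algebraicGenus (e x) = algebraicGenus x := by
  rw [algebraicGenus, algebraicGenus]
  congr 1
  ext g
  refine ⟨fun (h : HasRepresentation g (e x)) => ?_,
    fun (h : HasRepresentation g x) => h.map e.toMonoidHom⟩
  have := h.map e.symm.toMonoidHom
  rwa [MulEquiv.toMonoidHom_eq_coe, MonoidHom.coe_coe, e.symm_apply_apply] at this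

lemma minimalCount_le_mulEquiv [IsMulTorsionFree H] (e : G ≃* H) (x : G) :
    minimalCount x ≤ minimalCount (e x) := by
  refine Set.encard_le_encard_of_injOn (f := Subgroup.map e.toMonoidHom) ?_
    (Subgroup.map_injective e.injective).injOn
  rintro _ ⟨g, h, hg, ⟨hx, hinj, hprim⟩, rfl⟩
  have := (IsRootClosedHom.mulEquiv e).comp ⟨hinj, hprim⟩
  exact ⟨g, e.toMonoidHom.comp h, hg.trans (algebraicGenus_mulEquiv e x).symm,
    ⟨congrArg e hx, this.injective, this.isPrimitive⟩, MonoidHom.range_comp _ _⟩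

lemma fHat'_le_mulEquiv [IsMulTorsionFree H] (e : G ≃* H) (g : ℕ) : fHat' G g ≤ fHat' H g := by
  refine iSup₂_le fun x ⟨hx, hg⟩ => (minimalCount_le_mulEquiv e x).trans ?_
  rw [← hg, ← algebraicGenus_mulEquiv e]
  refine minimalCount_le_fHat' ?_
  have h := Subgroup.mem_map_of_mem e.toMonoidHom hx
  rw [commutator_def, Subgroup.map_commutator] at h
  exact Subgroup.commutator_mono le_top le_top h

lemma fHat'_mulEquiv [IsMulTorsionFree H] (e : G ≃* H) (g : ℕ) : fHat' G g = fHat' H g :=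
  have := isMulTorsionFree_of_mulEquiv e
  (fHat'_le_mulEquiv e g).antisymm (fHat'_le_mulEquiv e.symm g)

end Invariance

lemma mul_comm_of_subsingleton {X : Type*} [Subsingleton X] (x y : FreeGroup X) :
    x * y = y * x := by
  have hof : ∀ (c : X) (t : FreeGroup X), FreeGroup.of c * t = t * FreeGroup.of c := by
    intro c t
    suffices (MulAut.conj (FreeGroup.of c)).toMonoidHom = MonoidHom.id _ from
      mul_inv_eq_iff_eq_mul.1 (DFunLike.congr_fun this t)
    ext d
    simp [Subsingleton.elim d c]
  suffices (MulAut.conj x).toMonoidHom = MonoidHom.id _ from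
    mul_inv_eq_iff_eq_mul.1 (DFunLike.congr_fun this y)
  ext d
  simp [← hof]

/-! ### Supermultiplicativity -/

section Multiplicative

variable {X : Type*} {a b : X}

lemma range_glue {G : Type*} [Group G] {m n : ℕ} (f : SurfaceGroup m →* G)
    (f' : SurfaceGroup n →* G) : (glue f f').range = f.range ⊔ f'.range := by
  refine le_antisymm ?_ (sup_le ?_ ?_)
  · refine FreeGroup.range_lift_le ?_
    rintro _ ⟨⟨i, c⟩, rfl⟩
    induction i using Fin.addCases with
    | left i =>
      simp only [Fin.addCases_left]
      exact Subgroup.mem_sup_left ⟨_, rfl⟩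
    | right i =>
      simp only [Fin.addCases_right]
      exact Subgroup.mem_sup_right ⟨_, rfl⟩
  · rintro _ ⟨x, rfl⟩
    exact ⟨inclLeft m n x, glue_inclLeft f f' x⟩
  · rintro _ ⟨x, rfl⟩
    exact ⟨inclRight m n x, glue_inclRight f f' x⟩

/-- The subgroup generated by a copy of `S.1` in the first and a copy of `S.2` in the second free
factor. -/
def freeJoin (S : Subgroup (FreeGroup X) × Subgroup (FreeGroup X)) :
    Subgroup (FreeGroup (Bool × X)) :=
  S.1.map (FreeGroup.map (Prod.mk false)) ⊔ S.2.map (FreeGroup.map (Prod.mk true))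

/-- The retraction of the free group on two copies of `X` to the copy with index `β`. -/
def factorHom (X : Type*) (β : Bool) : FreeGroup (Bool × X) →* FreeGroup X :=
  FreeGroup.lift fun p => if p.1 = β then FreeGroup.of p.2 else 1

lemma factorHom_comp_map (β β' : Bool) :
    (factorHom X β).comp (FreeGroup.map (Prod.mk β')) = if β' = β then MonoidHom.id _ else 1 := by
  ext x
  by_cases h : β' = β <;> simp [factorHom, h]

/-- Retracting to one factor kills the other and returns the corresponding subgroup. -/
lemma freeJoin_injective : Function.Injective (freeJoin (X := X)) := by
  intro S T h
  have h0 := congrArg (Subgroup.map (factorHom X false)) h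
  have h1 := congrArg (Subgroup.map (factorHom X true)) h
  simp only [freeJoin, Subgroup.map_sup, Subgroup.map_map, factorHom_comp_map] at h0 h1
  simp [Subgroup.map_one_eq_bot] at h0 h1
  exact Prod.ext h0 h1

lemma minimalCount_mul_le (hab : a ≠ b) {ι : Bool × X → ℕ} (hι : Function.Injective ι)
    {x y : FreeGroup X} (hx : HasRepresentation (algebraicGenus x) x)
    (hy : HasRepresentation (algebraicGenus y) y) :
    minimalCount x * minimalCount y ≤ fHat' (FreeGroup X) (algebraicGenus x + algebraicGenus y) := by
  classical
  set m := algebraicGenus x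
  set n := algebraicGenus y
  set d := FreeGroup.map (Prod.mk false) x * FreeGroup.map (Prod.mk true) y
  -- The embedding depends on `d`: the code words need more gaps than a genus `m + n` pairing of the
  -- coded word can have bad corners.
  let M := 12 * (m + n) + 3 * (FreeGroup.map ι d).toWord.length + 1
  have hinv : ∀ t : FreeGroup (Bool × X), FreeGroup.lift (fun k =>
      if h : ∃ p, ι p = k then FreeGroup.of h.choose else 1) (FreeGroup.map ι t) = t := by
    intro t
    suffices (FreeGroup.lift (fun k => if h : ∃ p, ι p = k then FreeGroup.of h.choose else 1)).comp
      (FreeGroup.map ι) = MonoidHom.id _ from DFunLike.congr_fun this t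
    ext p
    have h : ∃ q, ι q = ι p := ⟨p, rfl⟩
    simp only [MonoidHom.comp_apply, FreeGroup.map.of, FreeGroup.lift_apply_of, dif_pos h]
    rw [hι h.choose_spec]
    rfl
  let Φ : FreeGroup (Bool × X) →* FreeGroup X := (codeHom a b M).comp (FreeGroup.map ι)
  have hΦ : IsRootClosedHom Φ :=
    (isRootClosedHom_codeHom hab).comp (.of_leftInverse _ hinv)
  have hz : HasRepresentation (m + n) (Φ d) := ((hx.map _).mul (hy.map _)).map Φ
  have hg : algebraicGenus (Φ d) = m + n := by
    refine (algebraicGenus_le hz).antisymm ?_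
    have h := hz.algebraicGenus.of_codeHom hab (by
      have := algebraicGenus_le hz
      omega)
    have h' := h.map (FreeGroup.lift (fun k =>
      if h : ∃ p, ι p = k then FreeGroup.of h.choose else 1))
    rw [hinv] at h'
    obtain ⟨r₁, r₂, hr, h₁, h₂⟩ := h'.of_map_mul_map
    exact (add_le_add (algebraicGenus_le h₁) (algebraicGenus_le h₂)).trans hr
  rw [← hg]
  refine le_trans ?_ (minimalCount_le_fHat' (mem_commutator_of_hasRepresentation hz))
  rw [minimalCount, minimalCount, ← Set.encard_prod]
  refine Set.encard_le_encard_of_injOn (f := fun S => (freeJoin S).map Φ) ?_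
    ((Subgroup.map_injective hΦ.injective).comp freeJoin_injective).injOn
  rintro ⟨_, _⟩ ⟨⟨_, h₁, rfl, ⟨hx₁, hi₁, hp₁⟩, rfl⟩, ⟨_, h₂, rfl, ⟨hx₂, hi₂, hp₂⟩, rfl⟩⟩
  have := hΦ.comp (isRootClosedHom_glue ⟨hi₁, hp₁⟩ ⟨hi₂, hp₂⟩)
  refine ⟨m + n, _, hg.symm, ⟨?_, this.injective, this.isPrimitive⟩, ?_⟩
  · rw [IsRepresentation, MonoidHom.comp_apply, glue_boundary, MonoidHom.comp_apply,
      MonoidHom.comp_apply (FreeGroup.map (Prod.mk true)),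
      MonoidHom.comp_apply (FreeGroup.map (Prod.mk false)), hx₁, hx₂]
    rfl
  · rw [MonoidHom.range_comp, range_glue, MonoidHom.range_comp, MonoidHom.range_comp]
    rfl

lemma hasRepresentation_of_minimalCount_ne_zero {G : Type*} [Group G] {x : G}
    (hx : minimalCount x ≠ 0) : HasRepresentation (algebraicGenus x) x := by
  obtain ⟨S, g, h, rfl, hh, -⟩ := Set.encard_ne_zero.1 hx
  exact ⟨h, hh.1⟩

lemma fHat'_mul_le [Countable X] (hab : a ≠ b) (m n : ℕ) :
    fHat' (FreeGroup X) m * fHat' (FreeGroup X) n ≤ fHat' (FreeGroup X) (m + n) := by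
  obtain ⟨ι, hι⟩ := exists_injective_nat (Bool × X)
  rw [fHat', fHat']
  simp only [ENat.iSup_mul, ENat.mul_iSup]
  refine iSup₂_le fun y hy => iSup₂_le fun x hx => ?_
  obtain ⟨-, rfl⟩ := hx
  obtain ⟨-, rfl⟩ := hy
  -- A nonzero count supplies a representation of genus `algebraicGenus`, which excludes the default
  -- value of `sInf`.
  by_cases h₁ : minimalCount x = 0
  · simp [h₁]
  by_cases h₂ : minimalCount y = 0
  · simp [h₂]
  exact minimalCount_mul_le hab hι (hasRepresentation_of_minimalCount_ne_zero h₁)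
    (hasRepresentation_of_minimalCount_ne_zero h₂)

end Multiplicative

end SurfaceReps

theorem mainTheorem3 (F : Type*) [Group F] [IsFreeGroup F] [Group.FG F]
    (hF : ∃ a b : F, a * b ≠ b * a) :
    2 ≤ SurfaceReps.fHat' F 1 ∧
      ∀ m n : ℕ,
        SurfaceReps.fHat' F m * SurfaceReps.fHat' F n ≤ SurfaceReps.fHat' F (m + n) := by
  let e := IsFreeGroup.toFreeGroup F
  obtain ⟨a, b, hab⟩ : ∃ a b : IsFreeGroup.Generators F, a ≠ b := by
    by_contra! h
    obtain ⟨x, y, hxy⟩ := hF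
    have : Subsingleton (IsFreeGroup.Generators F) := ⟨h⟩
    exact hxy (e.injective (by rw [map_mul, map_mul, SurfaceReps.mul_comm_of_subsingleton]))
  -- Countability lets two copies of the basis inject into `ℕ`, the index set of the code words.
  have : Countable (IsFreeGroup.Generators F) := by
    have : Countable F := by
      obtain ⟨α, hα, φ, hφ⟩ := Group.fg_iff_exists_freeGroup_hom_surjective.1 ‹Group.FG F›
      have := hα.countable.to_subtype
      have : Countable (FreeGroup α) := Quot.mk_surjective.countable
      exact hφ.countable
    exact (e.symm.injective.comp FreeGroup.of_injective).countable
  simp only [SurfaceReps.fHat'_mulEquiv e]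
  exact ⟨SurfaceReps.two_le_fHat'_one hab, SurfaceReps.fHat'_mul_le hab⟩
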